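/- Let $\Omega=\{0,1\}^{\mathbb N}$ be the set of infinite binary sequences, write $x_1^n=x_1\cdots x_n$ for the prefix of length $n$ of $x\in\Omega$ and $|s|$ for the length of a finite binary string $s$, and let $x_1^n/y_1^n$ be the subsequence of $x_1^n$ formed by those $x_i$, $1\le i\le n$, with $y_i=1$. For a probability measure $P$ on $\Omega$ and a finite string $s$ write $P(s)$ for the probability of the set of all sequences that extend $s$; $P$ is called computable if there is a computable rational valued function $A$ with $|P(s)-A(s,k)|<1/k$ for all finite strings $s$ and all integers $k\ge 1$. Let $K(s\mid t)$ be the conditional prefix Kolmogorov complexity of the string $s$ given the string $t$, with respect to an arbitrary fixed optimal prefix machine, and $K(s)=K(s\mid\text{empty string})$. Let $P$ be a computable probability measure on $\Omega$, and let $y\in\Omega$ have maximal complexity rate with respect to $P$, that is, $$\lim_{n\to\infty}\frac1n K(y_1^n)=\lim_{n\to\infty}-\frac1n\log_2 P(y_1^n),$$ where both limits exist and are equal (with $-\log_2 0=\infty$). Suppose also that $\lim_{n\to\infty}\frac1n\sum_{i=1}^n y_i$ exists and is positive. Then the following two statements are equivalent: (i) $\lim_{n\to\infty}\frac1n K(y_1^n)=0$;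 (ii) for every $x\in\Omega$, if $\lim_{n\to\infty}\frac1n K(x_1^n)=1$, then $$\lim_{n\to\infty}\frac{1}{|x_1^n/y_1^n|}K(x_1^n/y_1^n\mid y_1^n)=1.$$ -/

import Mathlib

open Filter Topology MeasureTheory

namespace AlgComplexity

/-- A (conditional) prefix machine: a partial recursive function taking a program `p` and a
condition `t` to an output `V p t`, such that for every condition `t` no halting program is a proper
prefix of another halting program. -/
structure IsPrefixMachine (V : List Bool → List Bool →. List Bool) : Prop where
  partrec : Partrec₂ V
  prefixFree : ∀ t p q : List Bool, (V p t).Dom → (V q t).Dom → p <+: q → p = q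

/-- An optimal (universal) prefix machine: up to an additive constant in the length of programs,
it describes strings at least as briefly as any other prefix machine, uniformly in the condition. -/
structure IsOptimalPrefixMachine (U : List Bool → List Bool →. List Bool) : Prop extends
    IsPrefixMachine U where
  optimal : ∀ V : List Bool → List Bool →. List Bool, IsPrefixMachine V →
    ∃ c : ℕ, ∀ t p s : List Bool, s ∈ V p t → ∃ q : List Bool, s ∈ U q t ∧ q.length ≤ p.length + c

/-- Conditional prefix Kolmogorov complexity `K(s | t)` with respect to the machine `U`: the length
of a shortest program from which `U` computes `s` given `t`. (For an optimal `U` such a program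
always exists.) -/
noncomputable def condK (U : List Bool → List Bool →. List Bool) (s t : List Bool) : ℕ :=
  sInf {n | ∃ p : List Bool, s ∈ U p t ∧ p.length = n}

/-- Prefix Kolmogorov complexity `K(s) = K(s | empty string)`. -/
noncomputable def prefixK (U : List Bool → List Bool →. List Bool) (s : List Bool) : ℕ :=
  condK U s []

/-- The finite prefix of length `n` of an infinite binary sequence. The terms of the sequence are
numbered from `0`, so this is `y 0, …, y (n - 1)`. -/
def initSeg (y : ℕ → Bool) (n : ℕ) : List Bool :=
  (List.range n).map y

/-- The substring of `s` formed by the entries at the positions where `t` has the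
entry `1` (`true`), in order. -/
def select (s t : List Bool) : List Bool :=
  ((s.zip t).filter fun a => a.2).map fun a => a.1

/-- The set of infinite binary sequences that extend the finite string `s`. -/
def cylinder (s : List Bool) : Set (ℕ → Bool) :=
  {ω | initSeg ω s.length = s}

/-- A probability `P` on infinite binary sequences is computable if there is a computable rational
valued function `A` with `|P(s) - A(s, k)| < 1 / k` for all strings `s` and all `k ≥ 1`.
(As `P(s) ≥ 0`, it is enough to consider nonnegative approximations; a rational is given
by its numerator and denominator.) -/
def IsComputableProb (P : Measure (ℕ → Bool)) : Prop :=
  ∃ A : List Bool → ℕ → ℚ≥0,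
    Computable₂ (fun s k => (A s k).num) ∧ Computable₂ (fun s k => (A s k).den) ∧
    ∀ (s : List Bool) (k : ℕ), 1 ≤ k → |P.real (cylinder s) - (A s k : ℝ)| < 1 / (k : ℝ)

/-- `y` has maximal complexity rate with respect to `P`: the limits of `K(y_1^n) / n` and
`-(1 / n) log₂ P(y_1^n)` both exist and are equal. The first quotient is bounded, so the common
limit is finite; in particular `P(y_1^n)` is never `0`, where `-log₂ 0` would be infinite. -/
def HasMaximalComplexityRate (U : List Bool → List Bool →. List Bool) (P : Measure (ℕ → Bool))
    (y : ℕ → Bool) : Prop :=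
  (∀ n : ℕ, 0 < P.real (cylinder (initSeg y n))) ∧
  ∃ h : ℝ,
    Tendsto (fun n : ℕ => (prefixK U (initSeg y n) : ℝ) / n) atTop (𝓝 h) ∧
    Tendsto (fun n : ℕ => -(Real.logb 2 (P.real (cylinder (initSeg y n)))) / n) atTop (𝓝 h)

end AlgComplexity

/- An optimal prefix machine exists, so the complexities above are defined. The machine `univ` reads
a program `1^e 0 p` and runs the `e`-th partial recursive function on `p`, after
restricting the domain of that function to a prefix-free set by dovetailing. -/

namespace AlgComplexity.Universal

open Nat.Partrec Encodable Denumerable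

/-- The `t`-th dovetailed step of the computation of function `e` under the condition `y`: if a
program is seen to halt at this step, that program and its (encoded) output. -/
def run (e : ℕ) (y : List Bool) (t : ℕ) : Option (List Bool × ℕ) :=
  (decode (α := ℕ × List Bool) t).bind fun a =>
    (Code.evaln a.1 (ofNat Code e) (encode (a.2, y))).map fun r => (a.2, r)

/-- Two different strings, one of which is a prefix of the other. -/
def Clash (p p' : List Bool) : Prop := p ≠ p' ∧ p.take p'.length = p'.take p.length

/-- The step result `o` does not clash with the program `p`. -/
def Ok (o : Option (List Bool × ℕ)) (p : List Bool) : Prop := ∀ a ∈ o.toList, ¬ Clash a.1 p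

theorem clash_of_prefix {p q : List Bool} (h : p <+: q) (hn : p ≠ q) : Clash p q := by
  obtain ⟨r, rfl⟩ := h
  exact ⟨hn, by simp⟩

theorem prefix_of_clash {p q : List Bool} (h : Clash p q) : p <+: q ∨ q <+: p := by
  rcases le_total p.length q.length with hl | hl
  · left; have := h.2; rw [List.take_of_length_le hl] at this; rw [this]; exact List.take_prefix _ _
  · right; have := h.2; rw [List.take_of_length_le hl] at this; rw [← this]; exact List.take_prefix _ _

theorem Clash.symm {p q : List Bool} (h : Clash p q) : Clash q p := ⟨h.1.symm, h.2.symm⟩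

theorem primrec_run : Primrec fun a : (ℕ × List Bool) × ℕ => run a.1.1 a.1.2 a.2 := by
  unfold run
  refine Primrec.option_bind (Primrec.decode.comp Primrec.snd) ?_
  refine Primrec.option_map ?_ ?_
  · refine Code.primrec_evaln.comp (Primrec.pair (Primrec.pair ?_ ?_) ?_)
    · exact Primrec.fst.comp Primrec.snd
    · exact (Primrec.ofNat Code).comp (Primrec.fst.comp (Primrec.fst.comp Primrec.fst))
    · exact Primrec.encode.comp (Primrec.pair (Primrec.snd.comp Primrec.snd)
        (Primrec.snd.comp (Primrec.fst.comp Primrec.fst)))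
  · exact Primrec.pair (Primrec.snd.comp (Primrec.snd.comp Primrec.fst)) Primrec.snd

theorem primrec_clash : PrimrecRel Clash := by
  refine PrimrecPred.and (PrimrecPred.not (Primrec.eq.comp Primrec.fst Primrec.snd))
    (Primrec.eq.comp ?_ ?_)
  · exact Primrec.list_take.comp (Primrec.list_length.comp Primrec.snd) Primrec.fst
  · exact Primrec.list_take.comp (Primrec.list_length.comp Primrec.fst) Primrec.snd

theorem primrec_ok : PrimrecRel Ok := by
  have h : PrimrecRel fun (a : List Bool × ℕ) (p : List Bool) => ¬ Clash a.1 p :=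
    PrimrecPred.not (primrec_clash.comp (Primrec.fst.comp Primrec.fst) Primrec.snd)
  exact h.forall_mem_list.comp (Primrec.optionToList.comp Primrec.fst) Primrec.snd

/-- No program seen to halt before step `t` clashes with `b.2`. -/
def Good (t : ℕ) (b : (ℕ × List Bool) × List Bool) : Prop :=
  ∀ t' < t, Ok (run b.1.1 b.1.2 t') b.2

theorem primrec_good : PrimrecRel Good := by
  have h : PrimrecRel fun (t' : ℕ) (b : (ℕ × List Bool) × List Bool) =>
      Ok (run b.1.1 b.1.2 t') b.2 :=
    primrec_ok.comp (primrec_run.comp (Primrec.pair (Primrec.fst.comp Primrec.snd) Primrec.fst))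
      (Primrec.snd.comp Primrec.snd)
  have h2 := h.forall_mem_list.comp (Primrec.list_range.comp Primrec.fst) Primrec.snd
  exact h2.of_eq fun a => by simp [Good]

open Classical in
/-- The output of `univ` on the program `q` as far as it is found at step `t`. -/
noncomputable def step (q y : List Bool) (t : ℕ) : Option (List Bool) :=
  (run (q.takeWhile id).length y t).bind fun a =>
    if q.dropWhile id = false :: a.1 ∧ Good t (((q.takeWhile id).length, y), a.1) then decode a.2
    else none

/-- The universal prefix machine. -/
noncomputable def univ (q y : List Bool) : Part (List Bool) := Nat.rfindOpt (step q y)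

theorem primrec_step : Primrec fun a : (List Bool × List Bool) × ℕ => step a.1.1 a.1.2 a.2 := by
  classical
  have hlen : Primrec fun a : (List Bool × List Bool) × ℕ => (a.1.1.takeWhile id).length :=
    Primrec.list_length.comp ((Primrec.list_takeWhile Primrec.id).comp (Primrec.fst.comp Primrec.fst))
  have hy : Primrec fun a : (List Bool × List Bool) × ℕ => a.1.2 := Primrec.snd.comp Primrec.fst
  unfold step
  refine Primrec.option_bind (primrec_run.comp (Primrec.pair (Primrec.pair hlen hy) Primrec.snd)) ?_
  refine Primrec.ite (PrimrecPred.and (Primrec.eq.comp ?_ ?_) (primrec_good.comp ?_ ?_)) ?_ ?_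
  · exact (Primrec.list_dropWhile Primrec.id).comp (Primrec.fst.comp (Primrec.fst.comp Primrec.fst))
  · exact Primrec.list_cons.comp (Primrec.const false) (Primrec.fst.comp Primrec.snd)
  · exact Primrec.snd.comp Primrec.fst
  · exact Primrec.pair (Primrec.pair (hlen.comp Primrec.fst) (hy.comp Primrec.fst))
      (Primrec.fst.comp Primrec.snd)
  · exact Primrec.decode.comp (Primrec.snd.comp Primrec.snd)
  · exact Primrec.const none

theorem partrec_univ : Partrec₂ univ :=
  Partrec.rfindOpt (f := fun a : List Bool × List Bool => step a.1 a.2) primrec_step.to_comp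

theorem dom_univ {q y : List Bool} (h : (univ q y).Dom) : ∃ t p r,
    run (q.takeWhile id).length y t = some (p, r) ∧ q.dropWhile id = false :: p ∧
    Good t (((q.takeWhile id).length, y), p) := by
  obtain ⟨t, a, ha⟩ := Nat.rfindOpt_dom.1 h
  simp only [step, Option.mem_def, Option.bind_eq_some_iff] at ha
  obtain ⟨⟨p, r⟩, h1, h2⟩ := ha
  split_ifs at h2 with hc
  exact ⟨t, p, r, h1, hc⟩

theorem isPrefixMachine_univ : IsPrefixMachine univ := by
  refine ⟨partrec_univ, fun y q q' h h' hp => ?_⟩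
  obtain ⟨t, p, r, h1, h2, h3⟩ := dom_univ h
  obtain ⟨t', p', r', h1', h2', h3'⟩ := dom_univ h'
  obtain ⟨s, rfl⟩ := hp
  have hq : q = q.takeWhile id ++ false :: p := by
    rw [← h2, List.takeWhile_append_dropWhile]
  have htw : ∀ a ∈ q.takeWhile id, id a = true := fun a ha => by
    simpa using List.mem_takeWhile_imp ha
  set w := q.takeWhile id with hw
  have e1 : (q ++ s).takeWhile id = w := by
    rw [hq, List.append_assoc, List.takeWhile_append_of_pos htw]; simp
  have e2 : (q ++ s).dropWhile id = false :: (p ++ s) := by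
    rw [hq, List.append_assoc, List.dropWhile_append_of_pos htw]; simp
  rw [e1] at h1' h3'
  rw [e2] at h2'
  obtain rfl : p ++ s = p' := by simpa using h2'
  by_contra hne
  have hcl : Clash p (p ++ s) := clash_of_prefix ⟨s, rfl⟩ (fun h => hne (by simpa using h))
  rcases lt_trichotomy t t' with hl | hl | hl
  · exact h3' t hl (p, r) (by simp [h1]) hcl
  · subst hl
    rw [h1] at h1'
    exact hcl.1 (by simpa using congrArg (fun o => o.map Prod.fst) h1')
  · exact h3 t' hl (p ++ s, r') (by simp [h1']) hcl.symm

theorem univ_optimal : IsOptimalPrefixMachine univ := by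
  refine ⟨isPrefixMachine_univ, fun V hV => ?_⟩
  obtain ⟨c, hc⟩ := Code.exists_code.1 hV.partrec
  refine ⟨encode c + 1, fun y p s hs => ?_⟩
  have hval : ∀ k p r, r ∈ Code.evaln k c (encode (p, y)) → ∃ x ∈ V p y, encode x = r := by
    intro k p r h
    have := Code.evaln_sound h
    rw [hc] at this
    simpa using this
  have hrun : ∀ t p r, run (encode c) y t = some (p, r) → ∃ x ∈ V p y, encode x = r := by
    intro t p r h
    simp only [run, Option.bind_eq_some_iff, Option.map_eq_some_iff] at h
    obtain ⟨a, -, r', h2, h3⟩ := h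
    cases h3
    rw [ofNat_encode] at h2
    exact hval _ _ _ h2
  have hs' : encode s ∈ Code.eval c (encode (p, y)) := by
    rw [hc]; simpa using hs
  obtain ⟨k, hk⟩ := Code.evaln_complete.1 hs'
  set q := List.replicate (encode c) true ++ false :: p with hq
  have e1 : (q.takeWhile id).length = encode c := by
    rw [hq, List.takeWhile_append_of_pos (by simp)]; simp
  have e2 : q.dropWhile id = false :: p := by
    rw [hq, List.dropWhile_append_of_pos (by simp)]; simp
  refine ⟨q, ?_, by simp [hq]; omega⟩
  have hgood : ∀ t, Good t ((encode c, y), p) := by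
    intro t t' _ a ha hcl
    obtain ⟨x, hx, -⟩ := hrun t' a.1 a.2 (by simpa using ha)
    have d1 := Part.dom_iff_mem.2 ⟨x, hx⟩
    have d2 := Part.dom_iff_mem.2 ⟨s, hs⟩
    rcases prefix_of_clash hcl with h | h
    · exact hcl.1 (hV.prefixFree y _ _ d1 d2 h)
    · exact hcl.1 (hV.prefixFree y _ _ d2 d1 h).symm
  have hdom : (univ q y).Dom := by
    refine Nat.rfindOpt_dom.2 ⟨encode (k, p), s, ?_⟩
    simp only [step, e1, e2, Option.mem_def, Option.bind_eq_some_iff]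
    refine ⟨(p, encode s), ?_, ?_⟩
    · simp only [run, encodek, Option.bind_some, ofNat_encode]
      rw [Option.mem_def.1 hk]; rfl
    · rw [if_pos ⟨e2, by rw [e1]; exact hgood _⟩, encodek]
  obtain ⟨x, hx⟩ := Part.dom_iff_mem.1 hdom
  obtain ⟨t, ht⟩ := Nat.rfindOpt_spec hx
  simp only [step, e1, e2, Option.mem_def, Option.bind_eq_some_iff] at ht
  obtain ⟨⟨p', r⟩, h1, h2⟩ := ht
  split_ifs at h2 with h3
  obtain rfl : p = p' := by simpa [e2] using h3.1
  obtain ⟨x', hx', he⟩ := hrun _ _ _ h1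
  subst he
  rw [encodek] at h2
  cases h2
  rwa [Part.mem_unique hs hx']

theorem exists_isOptimalPrefixMachine : ∃ U, IsOptimalPrefixMachine U :=
  ⟨univ, univ_optimal⟩

end AlgComplexity.Universal

open AlgComplexity

/-! (i) ⇒ (ii) is a chain rule. A prefix of `x` is determined by the prefix of `y`, the selected
bits and the unselected bits, so `K(x) ≤ K(y) + K(x/y | y) + (n - N) + O(log n)`, where `N` counts
the ones of `y` (`prefixK_le_chain`). If `K(x) ~ n`, `K(y) = o(n)` and `N ~ dn` with `d > 0`, the
selected bits cost at least `N - o(N)`, and they never cost more than `N + O(log N)`.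

For (ii) ⇒ (i), let the rate `h` of `y` be positive. `P` is replaced by positive computable integer
weights `γ` that still give `y` a code length of at most `(h + o(1)) n` (`exists_weights`). A
sequence `x` is drawn at random given `y` by the kernel `coupling`: given the past of `y`, the bit
`x_i` is uniform when `y_i` follows `γ`, but it leans towards the actual `y_i`. Two things then
hold.

The sequence `x` is incompressible. Averaged over `y` it is uniform, so strings with `K < l` have
total mass at most `2 ^ (l - n)`. By Markov's inequality, the prefixes of `y` that give these
strings conditional probability at least `2 ^ (-r)` have `γ`-mass at most `2 ^ (r + l - n)`. They
can be enumerated, so such a prefix would have a description about `n - l - r` bits shorter than its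
code length, which contradicts maximal complexity (`prefixK_le_of_simple_strings`,
`eventually_sum_simple_le`).

The selected bits are compressible given `y`. Where `y_i = 1`, the bit `x_i` is one with probability
`1/2 + e_i/2`, where `e_i` is the `γ`-probability of a zero there. Coding with half this bias gains
linearly many bits whenever the sum of `e_i²` over the ones is at least `εn` (`sum_tilt_le`). This
happens infinitely often (`exists_frequently_le_sum_sq`): otherwise nearly all ones are predicted
almost surely; raising the probability of zeros then costs little on the ones and would beat the
complexity of `y`, unless the zeros are predicted well too; but then all of `y` is cheap to code,
against `h > 0`.

Borel–Cantelli yields one `x` with both properties, which refutes (ii). -/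

namespace AlgComplexity

/-! ### Describing a string by its index in an effective enumeration -/

section Enumeration

/-- The number whose binary digits, most significant first, are the given bits. -/
def bitsVal (s : List Bool) : ℕ := s.foldl (fun n b => 2 * n + b.toNat) 0

theorem primrec_bitsVal : Primrec bitsVal := by
  have h : Primrec₂ fun (_ : List Bool) (z : ℕ × Bool) => 2 * z.1 + z.2.toNat :=
    Primrec.nat_add.comp (Primrec.nat_mul.comp (Primrec.const 2)
      (Primrec.fst.comp Primrec.snd)) ((Primrec.dom_bool Bool.toNat).comp
      (Primrec.snd.comp Primrec.snd))
  exact Primrec.list_foldl Primrec.id (Primrec.const 0) h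

theorem exists_bitsVal (w a : ℕ) (h : a < 2 ^ w) : ∃ s : List Bool, s.length = w ∧ bitsVal s = a := by
  induction w generalizing a with
  | zero => exact ⟨[], rfl, by simp at h; simp [bitsVal, h]⟩
  | succ w ih =>
    obtain ⟨s, hs, hv⟩ := ih (a / 2) (by rw [pow_succ] at h; omega)
    refine ⟨s ++ [a % 2 == 1], by simp [hs], ?_⟩
    have : bitsVal (s ++ [a % 2 == 1]) = 2 * bitsVal s + (a % 2 == 1).toNat := by simp [bitsVal]
    rw [this, hv]
    rcases Nat.mod_two_eq_zero_or_one a with h2 | h2 <;> simp [h2] <;> omega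

/-- The distinct strings among the first `j` values of `T`, in the order of their appearance. -/
def enum (T : ℕ → Option (List Bool)) (j : ℕ) : List (List Bool) :=
  Nat.rec [] (fun j acc => Option.casesOn (T j) acc
    (fun s => bif decide (∃ b ∈ acc, b = s) then acc else acc ++ [s])) j

theorem computable_enum {α : Type*} [Primcodable α] {T : α → ℕ → Option (List Bool)}
    (hT : Computable₂ T) : Computable₂ fun a j => enum (T a) j := by
  unfold enum
  refine Computable.nat_rec (f := fun z : α × ℕ => z.2) (g := fun _ => ([] : List (List Bool)))
    (h := fun z y => Option.casesOn (T z.1 y.1) y.2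
      (fun s => bif decide (∃ b ∈ y.2, b = s) then y.2 else y.2 ++ [s]))
    Computable.snd (Computable.const _) ?_
  refine Computable.option_casesOn
    (hT.comp (Computable.fst.comp Computable.fst) (Computable.fst.comp Computable.snd))
    (Computable.snd.comp Computable.snd) ?_
  have hm : Primrec₂ fun (L : List (List Bool)) (s : List Bool) => decide (∃ b ∈ L, b = s) :=
    (PrimrecRel.exists_mem_list (Primrec.eq (α := List Bool))).decide
  refine Computable.cond (hm.to_comp.comp ?_ Computable.snd) ?_ ?_
  · exact Computable.snd.comp (Computable.snd.comp Computable.fst)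
  · exact Computable.snd.comp (Computable.snd.comp Computable.fst)
  · exact Computable.list_concat.comp (Computable.snd.comp (Computable.snd.comp Computable.fst))
      Computable.snd

theorem enum_succ (T : ℕ → Option (List Bool)) (j : ℕ) :
    (∃ s, T j = some s ∧ s ∉ enum T j ∧ enum T (j + 1) = enum T j ++ [s]) ∨
    ((∀ s, T j = some s → s ∈ enum T j) ∧ enum T (j + 1) = enum T j) := by
  have h : enum T (j + 1) = Option.casesOn (T j) (enum T j)
    (fun s => bif decide (∃ b ∈ enum T j, b = s) then enum T j else enum T j ++ [s]) := rfl
  rw [h]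
  rcases hT : T j with _ | s
  · right; simp
  · by_cases hs : s ∈ enum T j
    · right; simp [hs]
    · left; exact ⟨s, rfl, hs, by simp [hs]⟩

theorem enum_nodup (T : ℕ → Option (List Bool)) (j : ℕ) : (enum T j).Nodup := by
  induction j with
  | zero => exact List.nodup_nil
  | succ j ih =>
    rcases enum_succ T j with ⟨s, _, hs, h⟩ | ⟨_, h⟩ <;> rw [h]
    · rw [← List.concat_eq_append]; exact ih.concat hs
    · exact ih

theorem mem_enum (T : ℕ → Option (List Bool)) (j : ℕ) (s : List Bool) (h : s ∈ enum T j) :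
    ∃ i, T i = some s := by
  induction j with
  | zero => exact absurd h List.not_mem_nil
  | succ j ih =>
    rcases enum_succ T j with ⟨s', h1, hs, h'⟩ | ⟨_, h'⟩ <;> rw [h'] at h
    · rcases List.mem_append.1 h with h | h
      · exact ih h
      · exact ⟨j, by rw [h1, List.mem_singleton.1 h]⟩
    · exact ih h

theorem mem_enum_succ (T : ℕ → Option (List Bool)) (j : ℕ) (s : List Bool) (h : T j = some s) :
    s ∈ enum T (j + 1) := by
  rcases enum_succ T j with ⟨s', h1, hs, h'⟩ | ⟨h1, h'⟩ <;> rw [h']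
  · rw [h1] at h; cases h; simp
  · exact h1 s h

/-- Lists only grow at the end, so the index of a string never changes once assigned and can serve
as its description. -/
theorem enum_prefix (T : ℕ → Option (List Bool)) {i j : ℕ} (h : i ≤ j) : enum T i <+: enum T j := by
  induction j, h using Nat.le_induction with
  | base => exact List.prefix_rfl
  | succ j _ ih =>
    rcases enum_succ T j with ⟨s, _, hs, h⟩ | ⟨_, h⟩ <;> rw [h]
    · exact ih.trans (List.prefix_append _ _)
    · exact ih

/-- The length of the initial block of ones. -/
def width (p : List Bool) : ℕ := (p.takeWhile id).length

/-- What follows the first `i` fields in a program `1^w 0 f₀ f₁ …` with fields of width `w`. -/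
def rest (p : List Bool) (i : ℕ) : List Bool := p.drop ((i + 1) * width p + 1)

/-- The number in the `i`-th field of the program `p`. -/
def field (p : List Bool) (i : ℕ) : ℕ := bitsVal ((rest p i).take (width p))

/-- The four parameters at the head of the program `p`. -/
def header (p : List Bool) : ℕ × ℕ × ℕ × ℕ := (field p 0, field p 1, field p 2, field p 3)

theorem primrec_width : Primrec width :=
  Primrec.list_length.comp (Primrec.list_takeWhile Primrec.id)

theorem primrec_rest (i : ℕ) : Primrec fun p => rest p i :=
  Primrec.list_drop.comp (Primrec.nat_add.comp (Primrec.nat_mul.comp (Primrec.const (i + 1))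
    primrec_width) (Primrec.const 1)) Primrec.id

theorem primrec_field (i : ℕ) : Primrec fun p => field p i :=
  primrec_bitsVal.comp (Primrec.list_take.comp primrec_width (primrec_rest i))

theorem primrec_header : Primrec header :=
  (primrec_field 0).pair ((primrec_field 1).pair ((primrec_field 2).pair (primrec_field 3)))

theorem rest_succ (p : List Bool) (i : ℕ) : rest p (i + 1) = (rest p i).drop (width p) := by
  simp only [rest, List.drop_drop]; congr 1; ring

theorem width_append {p r : List Bool} (h : width p < p.length) : width (p ++ r) = width p := by
  unfold width at *
  rw [List.takeWhile_append, if_neg h.ne]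

theorem rest_append {p r : List Bool} {i : ℕ} (h : (i + 1) * width p + 1 ≤ p.length) :
    rest (p ++ r) i = rest p i ++ r := by
  have h1 : width p < p.length := by
    have : width p ≤ (i + 1) * width p := Nat.le_mul_of_pos_left _ (by omega)
    omega
  rw [rest, width_append h1, List.drop_append_of_le_length h, rest]

/-- A field is read off an initial part of the program, so extending the program leaves it alone.
This makes the programs self-delimiting. -/
theorem field_append {p r : List Bool} {i : ℕ} (h : (i + 2) * width p + 1 ≤ p.length) :
    field (p ++ r) i = field p i := by
  have e : (i + 2) * width p = (i + 1) * width p + width p := by ring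
  have h1 : width p < p.length := by
    have : width p ≤ (i + 2) * width p := Nat.le_mul_of_pos_left _ (by omega)
    omega
  rw [field, width_append h1, rest_append (by omega), List.take_append_of_le_length, field]
  simp only [rest, List.length_drop]; omega

/-- The values enumerated by the decidable witness relation `S`. -/
def witnessed (S : List Bool → ℕ → Bool) (j : ℕ) : Option (List Bool) :=
  (Encodable.decode (α := List Bool × ℕ) j).bind fun z => bif S z.1 z.2 then some z.1 else none

theorem exists_witnessed (S : List Bool → ℕ → Bool) (s : List Bool) :
    (∃ j, witnessed S j = some s) ↔ ∃ k, S s k = true := by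
  constructor
  · rintro ⟨j, hj⟩
    simp only [witnessed, Option.bind_eq_some_iff] at hj
    obtain ⟨z, -, hz⟩ := hj
    rcases hS : S z.1 z.2 with _ | _
    · simp [hS] at hz
    · simp only [hS, cond_true, Option.some.injEq] at hz; exact ⟨z.2, hz ▸ hS⟩
  · rintro ⟨k, hk⟩
    exact ⟨Encodable.encode (s, k), by simp [witnessed, hk]⟩

/-- The programs of the form `1^w 0 f₀ f₁ f₂ f₃ f₄ i` where `i` has length `f₄`. -/
def WellFormed (p : List Bool) : Prop := p.length = 6 * width p + 1 + field p 4

instance : DecidablePred WellFormed := fun p => decEq p.length (6 * width p + 1 + field p 4)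

theorem primrec_wellFormed : PrimrecPred WellFormed :=
  Primrec.eq.comp Primrec.list_length (Primrec.nat_add.comp (Primrec.nat_add.comp
    (Primrec.nat_mul.comp (Primrec.const 6) primrec_width) (Primrec.const 1)) (primrec_field 4))

/-- The string that `enumMachine` has found after `j` steps, if any. -/
def enumStep {H : Type*} (hd : List Bool → H) (S : H → List Bool → List Bool → ℕ → Bool)
    (p t : List Bool) (j : ℕ) : Option (List Bool) :=
  bif decide (WellFormed p) then
    (enum (witnessed (S (hd p) t)) j)[bitsVal (rest p 5)]? else none

/-- The machine that outputs the `i`-th string witnessed by `S` with the parameters `hd p`. -/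
def enumMachine {H : Type*} (hd : List Bool → H) (S : H → List Bool → List Bool → ℕ → Bool)
    (p t : List Bool) : Part (List Bool) :=
  Nat.rfindOpt (enumStep hd S p t)

theorem computable_witnessed {H : Type*} [Primcodable H]
    {S : H → List Bool → List Bool → ℕ → Bool}
    (hS : Computable fun z : (H × List Bool) × (List Bool × ℕ) => S z.1.1 z.1.2 z.2.1 z.2.2) :
    Computable₂ fun (z : H × List Bool) j => witnessed (S z.1 z.2) j := by
  unfold witnessed
  refine Computable.option_bind (Computable.decode.comp Computable.snd) ?_
  have h1 : Computable fun y : ((H × List Bool) × ℕ) × (List Bool × ℕ) => (y.1.1, y.2) :=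
    (Computable.fst.comp Computable.fst).pair Computable.snd
  have h2 := hS.comp h1
  exact Computable.cond h2
    (Computable.option_some.comp (Computable.fst.comp Computable.snd)) (Computable.const none)

theorem computable_enumStep {H : Type*} [Primcodable H] {hd : List Bool → H} (hhd : Computable hd)
    {S : H → List Bool → List Bool → ℕ → Bool}
    (hS : Computable fun z : (H × List Bool) × (List Bool × ℕ) => S z.1.1 z.1.2 z.2.1 z.2.2) :
    Computable fun z : (List Bool × List Bool) × ℕ => enumStep hd S z.1.1 z.1.2 z.2 := by
  have h1 : Computable fun z : (List Bool × List Bool) × ℕ => z.1.1 :=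
    Computable.fst.comp Computable.fst
  have h2 : Computable fun z : (List Bool × List Bool) × ℕ => (hd z.1.1, z.1.2) :=
    (hhd.comp h1).pair (Computable.snd.comp Computable.fst)
  have h3 := (computable_enum (computable_witnessed hS)).comp h2 Computable.snd
  have h4 : Computable fun z : (List Bool × List Bool) × ℕ => bitsVal (rest z.1.1 5) :=
    (primrec_bitsVal.comp (primrec_rest 5)).to_comp.comp h1
  exact Computable.cond (primrec_wellFormed.decide.to_comp.comp h1)
    (Computable.list_getElem?.comp h3 h4) (Computable.const none)

/-- A halting program is well formed, and its length is fixed by its block width and its fifth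
field. A proper extension has the same width and field but a greater length, so it is not well
formed. -/
theorem isPrefixMachine_enumMachine {H : Type*} [Primcodable H] {hd : List Bool → H}
    (hhd : Computable hd)
    {S : H → List Bool → List Bool → ℕ → Bool}
    (hS : Computable fun z : (H × List Bool) × (List Bool × ℕ) => S z.1.1 z.1.2 z.2.1 z.2.2) :
    IsPrefixMachine (enumMachine hd S) := by
  constructor
  · exact Partrec.rfindOpt (f := fun (z : List Bool × List Bool) j => enumStep hd S z.1 z.2 j)
      (computable_enumStep hhd hS)
  · intro t p q hp hq hpq
    have key : ∀ p, (enumMachine hd S p t).Dom → WellFormed p := by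
      intro p hp
      obtain ⟨n, a, ha⟩ := Nat.rfindOpt_dom.1 hp
      by_contra hc
      simp [enumStep, hc] at ha
    have h1 := key p hp
    have h2 := key q hq
    obtain ⟨r, rfl⟩ := hpq
    unfold WellFormed at h1 h2
    rw [width_append (by omega), field_append (by omega)] at h2
    have : r.length = 0 := by rw [List.length_append] at h2; omega
    rw [List.length_eq_zero_iff.1 this, List.append_nil]

theorem condK_le {U : List Bool → List Bool →. List Bool} {p s t : List Bool} (h : s ∈ U p t) :
    condK U s t ≤ p.length := Nat.sInf_le ⟨p, h, rfl⟩

/-- A relation between strings `t`, `s` and witnesses `k`, with four parameters, is computable. -/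
structure ComputableFamily (S : ℕ → ℕ → ℕ → ℕ → List Bool → List Bool → ℕ → Bool) : Prop where
  comp : ∀ {α : Type} [Primcodable α] {a₀ a₁ a₂ a₃ : α → ℕ} {t s : α → List Bool} {k : α → ℕ},
    Computable a₀ → Computable a₁ → Computable a₂ → Computable a₃ → Computable t → Computable s →
    Computable k → Computable fun x => S (a₀ x) (a₁ x) (a₂ x) (a₃ x) (t x) (s x) (k x)

/-- If the strings witnessed by a computable relation number at most `2 ^ L`, then each of them
has complexity at most `L` up to a logarithmic term. -/
theorem condK_le_of_enum {U : List Bool → List Bool →. List Bool} (hU : IsOptimalPrefixMachine U)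
    {S : ℕ → ℕ → ℕ → ℕ → List Bool → List Bool → ℕ → Bool} (hS : ComputableFamily S) :
    ∃ c : ℕ, ∀ (M a₀ a₁ a₂ a₃ L : ℕ) (t s : List Bool), a₀ ≤ M → a₁ ≤ M → a₂ ≤ M → a₃ ≤ M → L ≤ M →
      (∀ l : List (List Bool), l.Nodup → (∀ s ∈ l, ∃ k, S a₀ a₁ a₂ a₃ t s k = true) →
        l.length ≤ 2 ^ L) → (∃ k, S a₀ a₁ a₂ a₃ t s k = true) →
      condK U s t ≤ L + 6 * Nat.size M + c := by
  set S' : ℕ × ℕ × ℕ × ℕ → List Bool → List Bool → ℕ → Bool :=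
    fun h => S h.1 h.2.1 h.2.2.1 h.2.2.2 with hS'
  have hc' : Computable fun z : ((ℕ × ℕ × ℕ × ℕ) × List Bool) × (List Bool × ℕ) =>
      S' z.1.1 z.1.2 z.2.1 z.2.2 := by
    have h : Computable fun z : ((ℕ × ℕ × ℕ × ℕ) × List Bool) × (List Bool × ℕ) => z.1.1 :=
      Computable.fst.comp Computable.fst
    have h2 := Computable.snd.comp h
    have h3 := Computable.snd.comp h2
    exact hS.comp (Computable.fst.comp h) (Computable.fst.comp h2) (Computable.fst.comp h3)
      (Computable.snd.comp h3) (Computable.snd.comp Computable.fst)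
      (Computable.fst.comp Computable.snd) (Computable.snd.comp Computable.snd)
  classical
  obtain ⟨c, hc⟩ := hU.optimal _ (isPrefixMachine_enumMachine primrec_header.to_comp hc')
  refine ⟨c + 1, fun M a₀ a₁ a₂ a₃ L t s h0 h1 h2 h3 h4 hcard hs => ?_⟩
  -- All five numbers are at most `M`, so they fit into fields of width `w`. The unary width and the
  -- five fields account for `6 * w`, and the delimiter for the `+ 1` in the constant.
  set w := Nat.size M with hw
  have hM : ∀ a ≤ M, a < 2 ^ w := fun a ha => ha.trans_lt (Nat.lt_size_self M)
  obtain ⟨b0, l0, v0⟩ := exists_bitsVal w a₀ (hM _ h0)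
  obtain ⟨b1, l1, v1⟩ := exists_bitsVal w a₁ (hM _ h1)
  obtain ⟨b2, l2, v2⟩ := exists_bitsVal w a₂ (hM _ h2)
  obtain ⟨b3, l3, v3⟩ := exists_bitsVal w a₃ (hM _ h3)
  obtain ⟨b4, l4, v4⟩ := exists_bitsVal w L (hM _ h4)
  set T := witnessed (S' (a₀, a₁, a₂, a₃) t) with hT
  obtain ⟨j, hj⟩ := (exists_witnessed _ _).2 hs
  obtain ⟨i, hi, his⟩ := List.getElem_of_mem (mem_enum_succ T j s hj)
  -- The enumerated strings are distinct and witnessed, hence at most `2 ^ L` in number, and the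
  -- index `i` can be written with exactly `L` bits.
  have hlen := hcard (enum T (j + 1)) (enum_nodup T _)
    (fun s hs => (exists_witnessed _ _).1 (mem_enum T _ s hs))
  obtain ⟨b5, l5, v5⟩ := exists_bitsVal L i (by omega)
  set B := b0 ++ (b1 ++ (b2 ++ (b3 ++ (b4 ++ b5)))) with hB
  set p := List.replicate w true ++ false :: B with hp
  have hwp : width p = w := by
    rw [width, hp, List.takeWhile_append_of_pos (by simp)]; simp
  have r0 : rest p 0 = b0 ++ (b1 ++ (b2 ++ (b3 ++ (b4 ++ b5)))) := by
    rw [rest, hwp, hp, zero_add, one_mul, List.drop_append]; simp [hB]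
  have r1 : rest p 1 = b1 ++ (b2 ++ (b3 ++ (b4 ++ b5))) := by
    rw [rest_succ, r0, hwp]; exact List.drop_left' l0
  have r2 : rest p 2 = b2 ++ (b3 ++ (b4 ++ b5)) := by
    rw [rest_succ, r1, hwp]; exact List.drop_left' l1
  have r3 : rest p 3 = b3 ++ (b4 ++ b5) := by
    rw [rest_succ, r2, hwp]; exact List.drop_left' l2
  have r4 : rest p 4 = b4 ++ b5 := by
    rw [rest_succ, r3, hwp]; exact List.drop_left' l3
  have r5 : rest p 5 = b5 := by
    rw [rest_succ, r4, hwp]; exact List.drop_left' l4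
  have f0 : field p 0 = a₀ := by rw [field, r0, hwp, List.take_left' l0, v0]
  have f1 : field p 1 = a₁ := by rw [field, r1, hwp, List.take_left' l1, v1]
  have f2 : field p 2 = a₂ := by rw [field, r2, hwp, List.take_left' l2, v2]
  have f3 : field p 3 = a₃ := by rw [field, r3, hwp, List.take_left' l3, v3]
  have f4 : field p 4 = L := by rw [field, r4, hwp, List.take_left' l4, v4]
  have hplen : p.length = 6 * w + 1 + L := by
    simp [hp, hB, l0, l1, l2, l3, l4, l5]; ring
  have hwf : WellFormed p := by rw [WellFormed, hplen, hwp, f4]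
  have hout : s ∈ enumMachine header S' p t := by
    -- The search may stop earlier than step `j + 1`, but the `i`-th entry is stable once present,
    -- so the answer is the same.
    have e : enumMachine header S' p t = Nat.rfindOpt fun j => (enum T j)[i]? := by
      unfold enumMachine
      congr 1; funext j
      simp only [enumStep, hwf, decide_true, cond_true, header, f0, f1, f2, f3, r5, v5, hT]
    rw [e, Nat.rfindOpt_mono]
    · exact ⟨j + 1, by rw [Option.mem_def, List.getElem?_eq_getElem hi, his]⟩
    · intro a m n hmn ha
      obtain ⟨r, hr⟩ := enum_prefix T hmn
      rw [Option.mem_def] at ha ⊢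
      rw [← hr, List.getElem?_append_left (List.getElem?_eq_some_iff.1 ha).1, ha]
  obtain ⟨q, hq, hql⟩ := hc t p s hout
  have := condK_le hq
  omega

end Enumeration

end AlgComplexity

namespace AlgComplexity

/-! ### Computable sums and products, and products of conditional weights -/

section Computability

variable {α : Type*} [Primcodable α]

theorem computable_add {f g : α → ℕ} (hf : Computable f) (hg : Computable g) :
    Computable fun a => f a + g a := Primrec.nat_add.to_comp.comp hf hg

theorem computable_mul {f g : α → ℕ} (hf : Computable f) (hg : Computable g) :
    Computable fun a => f a * g a := Primrec.nat_mul.to_comp.comp hf hg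

theorem computable_pow {f g : α → ℕ} (hf : Computable f) (hg : Computable g) :
    Computable fun a => f a ^ g a :=
  (Primrec₂.unpaired'.1 Nat.Primrec.pow).to_comp.comp hf hg

theorem computable_decide_le {f g : α → ℕ} (hf : Computable f) (hg : Computable g) :
    Computable fun a => decide (f a ≤ g a) := Primrec.nat_le.decide.to_comp.comp hf hg

theorem computable_decide_eq {β : Type*} [Primcodable β] [DecidableEq β] {f g : α → β}
    (hf : Computable f) (hg : Computable g) :
    Computable fun a => decide (f a = g a) := Primrec.eq.decide.to_comp.comp hf hg

theorem computable_and {f g : α → Bool} (hf : Computable f) (hg : Computable g) :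
    Computable fun a => f a && g a := Primrec.and.to_comp.comp hf hg

theorem computable_prod_range {g : α → ℕ → ℕ} {n : α → ℕ} (hg : Computable₂ g)
    (hn : Computable n) : Computable fun a => ∏ i ∈ Finset.range (n a), g a i := by
  have h : Computable₂ fun (a : α) (z : ℕ × ℕ) => z.2 * g a z.1 :=
    computable_mul (Computable.snd.comp Computable.snd)
      (hg.comp Computable.fst (Computable.fst.comp Computable.snd))
  refine (Computable.nat_rec hn (Computable.const 1) h).of_eq fun a => ?_
  induction n a with
  | zero => rfl
  | succ k ih => rw [Finset.prod_range_succ, ← ih]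

theorem computable_sum_range {g : α → ℕ → ℕ} {n : α → ℕ} (hg : Computable₂ g)
    (hn : Computable n) : Computable fun a => ∑ i ∈ Finset.range (n a), g a i := by
  have h : Computable₂ fun (a : α) (z : ℕ × ℕ) => z.2 + g a z.1 :=
    computable_add (Computable.snd.comp Computable.snd)
      (hg.comp Computable.fst (Computable.fst.comp Computable.snd))
  refine (Computable.nat_rec hn (Computable.const 0) h).of_eq fun a => ?_
  induction n a with
  | zero => rfl
  | succ k ih => rw [Finset.sum_range_succ, ← ih]

theorem sum_map_eq_sum_range {β : Type*} (l : List β) (d : β) (g : β → ℕ) :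
    (l.map g).sum = ∑ i ∈ Finset.range l.length, g (l.getD i d) := by
  induction l with
  | nil => simp
  | cons b l ih => simp [Finset.sum_range_succ', ih, add_comm]

theorem computable_list_sum {β : Type*} [Primcodable β] [Inhabited β] {l : α → List β}
    {g : α → β → ℕ} (hl : Computable l) (hg : Computable₂ g) :
    Computable fun a => ((l a).map (g a)).sum := by
  have h1 : Computable₂ fun (a : α) (i : ℕ) => (l a).getD i default :=
    (Primrec.list_getD default).to_comp.comp (hl.comp Computable.fst) Computable.snd
  have h2 : Computable₂ fun (a : α) (i : ℕ) => g a ((l a).getD i default) :=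
    hg.comp Computable.fst h1
  exact (computable_sum_range h2 (Computable.list_length.comp hl)).of_eq fun a =>
    (sum_map_eq_sum_range _ _ _).symm

theorem computable_getD {l : α → List Bool} {i : α → ℕ} (hl : Computable l) (hi : Computable i) :
    Computable fun a => (l a).getD (i a) false := (Primrec.list_getD false).to_comp.comp hl hi

theorem computable_take {l : α → List Bool} {i : α → ℕ} (hl : Computable l) (hi : Computable i) :
    Computable fun a => (l a).take (i a) := Primrec.list_take.to_comp.comp hi hl

/-- The strings of length `n`. -/
def strs (n : ℕ) : List (List Bool) :=
  Nat.rec [[]] (fun _ l => l.flatMap fun s => [s ++ [false], s ++ [true]]) n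

theorem primrec_strs : Primrec strs := by
  have h : Primrec₂ fun (_ : ℕ) (l : List (List Bool)) =>
      l.flatMap fun s => [s ++ [false], s ++ [true]] := by
    refine Primrec.list_flatMap Primrec.snd ?_
    have h1 : ∀ b : Bool, Primrec fun z : (ℕ × List (List Bool)) × List Bool => z.2 ++ [b] :=
      fun b => Primrec.list_concat.comp Primrec.snd (Primrec.const b)
    exact Primrec.list_cons.comp (h1 false)
      (Primrec.list_cons.comp (h1 true) (Primrec.const []))
  exact Primrec.nat_rec₁ [[]] h

theorem strs_succ (n : ℕ) :
    strs (n + 1) = (strs n).flatMap fun s => [s ++ [false], s ++ [true]] := rfl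

theorem mem_strs {n : ℕ} {s : List Bool} : s ∈ strs n ↔ s.length = n := by
  induction n generalizing s with
  | zero => simp [strs]
  | succ n ih =>
    rw [strs_succ]
    simp only [List.mem_flatMap, ih, List.mem_cons, List.not_mem_nil, or_false]
    constructor
    · rintro ⟨a, ha, rfl | rfl⟩ <;> simp [ha]
    · intro h
      rcases List.eq_nil_or_concat s with rfl | ⟨l, b, rfl⟩
      · simp at h
      · refine ⟨l, by simpa using h, ?_⟩
        cases b <;> simp

theorem nodup_strs (n : ℕ) : (strs n).Nodup := by
  induction n with
  | zero => simp [strs]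
  | succ n ih =>
    rw [strs_succ, List.nodup_flatMap]
    refine ⟨fun s _ => by simp, ih.imp_of_mem fun {a b} _ _ hne => ?_⟩
    rw [Function.onFun, List.disjoint_left]
    intro s h1 h2
    simp only [List.mem_cons, List.not_mem_nil, or_false] at h1 h2
    rcases h1 with rfl | rfl <;> rcases h2 with h2 | h2 <;>
      exact hne (List.append_inj_left' h2 rfl)

theorem length_strs (n : ℕ) : (strs n).length = 2 ^ n := by
  induction n with
  | zero => rfl
  | succ n ih => rw [strs_succ, List.length_flatMap]; simp [ih, pow_succ]

theorem sum_strs_succ {R : Type*} [AddCommMonoid R] (n : ℕ) (f : List Bool → R) :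
    ((strs (n + 1)).map f).sum =
      ((strs n).map fun s => f (s ++ [false]) + f (s ++ [true])).sum := by
  rw [strs_succ]
  induction strs n with
  | nil => simp
  | cons s l ih => rw [List.flatMap_cons, List.map_append, List.sum_append, ih]; simp

/-- The sum over all strings of length `n` of a product of conditional weights that depend on the
preceding bits, when the total weight at each position does not. -/
theorem sum_strs_prod {R : Type*} [CommSemiring R] (n : ℕ) (g : ℕ → List Bool → Bool → R)
    (h : ℕ → R) (hg : ∀ i < n, ∀ c : List Bool, c.length = i → g i c false + g i c true = h i) :
    ((strs n).map fun s => ∏ i ∈ Finset.range n, g i (s.take i) (s.getD i false)).sum =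
      ∏ i ∈ Finset.range n, h i := by
  induction n with
  | zero => simp [strs]
  | succ n ih =>
    rw [sum_strs_succ, Finset.prod_range_succ, ← ih fun i hi => hg i (by omega),
      ← List.sum_map_mul_right]
    congr 1
    refine List.map_congr_left fun s hs => ?_
    have hl := mem_strs.1 hs
    have key : ∀ b, ∏ i ∈ Finset.range (n + 1), g i ((s ++ [b]).take i) ((s ++ [b]).getD i false) =
        (∏ i ∈ Finset.range n, g i (s.take i) (s.getD i false)) * g n s b := by
      intro b
      rw [Finset.prod_range_succ]
      congr 1
      · refine Finset.prod_congr rfl fun i hi => ?_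
        have hi := Finset.mem_range.1 hi
        rw [List.take_append_of_le_length (by omega), List.getD_append _ _ _ _ (by omega)]
      · rw [List.take_left' hl, List.getD_append_right _ _ _ _ (by omega)]; simp [hl]
    rw [key, key, ← mul_add, hg n (by omega) s hl]

/-- The product along `t` and `x` of weights `w` that depend on the preceding bits of `t` and on the
current bits of `t` and `x`. -/
def wprod {R : Type*} [CommMonoid R] (w : List Bool → Bool → Bool → R) (t x : List Bool) : R :=
  ∏ i ∈ Finset.range t.length, w (t.take i) (t.getD i false) (x.getD i false)

theorem computable_wprod {w : List Bool → Bool → Bool → ℕ}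
    (hw : Computable fun z : List Bool × Bool × Bool => w z.1 z.2.1 z.2.2) {t x : α → List Bool}
    (ht : Computable t) (hx : Computable x) : Computable fun a => wprod w (t a) (x a) := by
  unfold wprod
  refine computable_prod_range ?_ (Computable.list_length.comp ht)
  have h1 := ht.comp (Computable.fst (α := α) (β := ℕ))
  have h2 := hx.comp (Computable.fst (α := α) (β := ℕ))
  exact hw.comp ((computable_take h1 Computable.snd).pair
    ((computable_getD h1 Computable.snd).pair (computable_getD h2 Computable.snd)))

/-- A list version of `select`, convenient for showing computability. -/
def selectAt (s t : List Bool) : List Bool :=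
  (List.range t.length).flatMap fun i => bif t.getD i false then [s.getD i false] else []

theorem primrec_selectAt : Primrec₂ selectAt := by
  refine Primrec.list_flatMap (Primrec.list_range.comp (Primrec.list_length.comp Primrec.snd)) ?_
  refine Primrec.cond ?_ ?_ (Primrec.const [])
  · exact (Primrec.list_getD false).comp (Primrec.snd.comp Primrec.fst) Primrec.snd
  · exact Primrec.list_cons.comp ((Primrec.list_getD false).comp (Primrec.fst.comp Primrec.fst)
      Primrec.snd) (Primrec.const [])

theorem selectAt_eq_select {s t : List Bool} (h : s.length = t.length) :
    selectAt s t = select s t := by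
  induction t generalizing s with
  | nil => simp [selectAt, select]
  | cons b t ih =>
    cases s with
    | nil => simp at h
    | cons a s =>
      have := ih (s := s) (by simpa using h)
      rw [selectAt] at this
      rw [selectAt, List.length_cons, List.range_succ_eq_map, List.flatMap_cons, List.flatMap_map]
      cases b <;> simp [select] at this ⊢ <;> exact this

/-- The computations of a partial recursive function are exhausted by a computable family of
decidable stages. -/
theorem exists_stages {U : List Bool → List Bool →. List Bool} (hU : Partrec₂ U) :
    ∃ R : ℕ → List Bool → List Bool → List Bool → Bool,
      (Primrec fun z : (ℕ × List Bool) × List Bool × List Bool => R z.1.1 z.1.2 z.2.1 z.2.2) ∧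
      (∀ p t s, s ∈ U p t ↔ ∃ k, R k p t s = true) ∧
      ∀ k k' p t s, k ≤ k' → R k p t s = true → R k' p t s = true := by
  obtain ⟨c, hc⟩ := Nat.Partrec.Code.exists_code.1 hU
  refine ⟨fun k p t s => decide (Nat.Partrec.Code.evaln k c (Encodable.encode (p, t)) =
    some (Encodable.encode s)), ?_, ?_, ?_⟩
  · refine Primrec.eq.decide.comp (Nat.Partrec.Code.primrec_evaln.comp (Primrec.pair
      (Primrec.pair (Primrec.fst.comp Primrec.fst) (Primrec.const c)) (Primrec.encode.comp
        (Primrec.pair (Primrec.snd.comp Primrec.fst) (Primrec.fst.comp Primrec.snd)))))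
      (Primrec.option_some.comp (Primrec.encode.comp (Primrec.snd.comp Primrec.snd)))
  · intro p t s
    have h1 : Encodable.encode s ∈ c.eval (Encodable.encode (p, t)) ↔ s ∈ U p t := by
      rw [hc]; simp
    rw [← h1, Nat.Partrec.Code.evaln_complete]
    simp only [decide_eq_true_eq, Option.mem_def]
  · intro k k' p t s hk h
    simp only [decide_eq_true_eq] at h ⊢
    exact Nat.Partrec.Code.evaln_mono hk h

end Computability

end AlgComplexity

namespace AlgComplexity

/-! ### Prefixes and selected subsequences -/

section InitialSegments

@[simp] theorem length_initSeg (y : ℕ → Bool) (n : ℕ) : (initSeg y n).length = n := by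
  simp [initSeg]

theorem take_initSeg (y : ℕ → Bool) {i n : ℕ} (h : i ≤ n) :
    (initSeg y n).take i = initSeg y i := by
  rw [initSeg, ← List.map_take, List.take_range, min_eq_left h, initSeg]

theorem getD_initSeg (y : ℕ → Bool) {i n : ℕ} (h : i < n) : (initSeg y n).getD i false = y i := by
  simp [initSeg, List.getD, h]

theorem initSeg_succ (y : ℕ → Bool) (n : ℕ) : initSeg y (n + 1) = initSeg y n ++ [y n] := by
  simp [initSeg, List.range_succ]

theorem wprod_initSeg {R : Type*} [CommMonoid R] (w : List Bool → Bool → Bool → R)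
    (y x : ℕ → Bool) (n : ℕ) : wprod w (initSeg y n) (initSeg x n) =
      ∏ i ∈ Finset.range n, w (initSeg y i) (y i) (x i) := by
  rw [wprod, length_initSeg]
  refine Finset.prod_congr rfl fun i hi => ?_
  have hi := Finset.mem_range.1 hi
  rw [take_initSeg y hi.le, getD_initSeg y hi, getD_initSeg x hi]

theorem select_append {s t s' t' : List Bool} (h : s.length = t.length) :
    select (s ++ s') (t ++ t') = select s t ++ select s' t' := by
  simp [select, List.zip_append h]

theorem select_initSeg_succ (x y : ℕ → Bool) (n : ℕ) :
    select (initSeg x (n + 1)) (initSeg y (n + 1)) =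
      select (initSeg x n) (initSeg y n) ++ if y n then [x n] else [] := by
  rw [initSeg_succ, initSeg_succ, select_append (by simp)]
  congr 1
  cases h : y n <;> simp [select]

theorem select_initSeg_congr {x x' y : ℕ → Bool} (h : ∀ i, y i = true → x i = x' i) (n : ℕ) :
    select (initSeg x n) (initSeg y n) = select (initSeg x' n) (initSeg y n) := by
  induction n with
  | zero => rfl
  | succ n ih =>
    rw [select_initSeg_succ, select_initSeg_succ, ih]
    by_cases hy : y n = true
    · simp [hy, h n hy]
    · simp [hy]

theorem length_select {s t : List Bool} (h : s.length = t.length) :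
    (select s t).length = t.count true := by
  induction t generalizing s with
  | nil => simp [select]
  | cons b t ih =>
    cases s with
    | nil => simp at h
    | cons a s =>
      have := ih (s := s) (by simpa using h)
      cases b <;> simp [select] at this ⊢ <;> exact this

/-- The selected and the unselected entries together can be merged along `t`. This injectivity
underlies the chain rule. -/
theorem eq_of_select_eq {s s' t : List Bool} (h : s.length = t.length) (h' : s'.length = t.length)
    (h1 : select s t = select s' t) (h2 : select s (t.map not) = select s' (t.map not)) :
    s = s' := by
  induction t generalizing s s' with
  | nil => simp at h h'; rw [h, h']
  | cons b t ih =>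
    obtain _ | ⟨a, s⟩ := s
    · simp at h
    obtain _ | ⟨a', s'⟩ := s'
    · simp at h'
    have ih := ih (s := s) (s' := s') (by simpa using h) (by simpa using h')
    cases b <;> simp [select] at h1 h2 ih ⊢ <;> tauto

end InitialSegments

/-! ### Unconditional upper bounds by coding -/

section UpperBounds

variable {U : List Bool → List Bool →. List Bool}

/-- Optimality against the machine that prints `s` on the empty program shows that some program
exists, so `condK` is a true minimum and not the default infimum of an empty set. -/
theorem exists_program (hU : IsOptimalPrefixMachine U) (s t : List Bool) :
    ∃ p, s ∈ U p t ∧ p.length = condK U s t := by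
  let V : List Bool → List Bool →. List Bool := fun p _ =>
    ((bif decide (p = []) then some s else none : Option (List Bool)) : Part (List Bool))
  have hV : IsPrefixMachine V := by
    refine ⟨?_, fun t p q hp hq _ => ?_⟩
    · have h : Computable fun z : List Bool × List Bool =>
          (bif decide (z.1 = []) then some s else none : Option (List Bool)) :=
        Computable.cond (computable_decide_eq Computable.fst (Computable.const []))
          (Computable.const _) (Computable.const _)
      exact h.ofOption
    · have key : ∀ p, (V p t).Dom → p = [] := by
        intro p hp
        by_contra hne
        simp [V, hne] at hp
      rw [key p hp, key q hq]
  obtain ⟨c, hc⟩ := hU.optimal V hV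
  obtain ⟨q, hq, -⟩ := hc t [] s (by simp [V])
  exact Nat.sInf_mem (s := {n | ∃ p : List Bool, s ∈ U p t ∧ p.length = n}) ⟨_, q, hq, rfl⟩

/-- The Markov-type count behind the coding lemmas: few strings can have large mass when the total
mass is bounded. -/
theorem length_mul_le_of_sum {l : List (List Bool)} (hl : l.Nodup) {n : ℕ}
    (hn : ∀ s ∈ l, s ∈ strs n) {f : List Bool → ℝ} (h0 : ∀ s, 0 ≤ f s) {A B : ℝ}
    (hsum : ((strs n).map f).sum ≤ A) (h1 : ∀ s ∈ l, B ≤ f s) : l.length * B ≤ A := by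
  have e1 : (l.length : ℝ) * B ≤ (l.map f).sum := by
    have := List.card_nsmul_le_sum (l.map f) B (by simpa using h1)
    simpa using this
  refine e1.trans (le_trans ?_ hsum)
  rw [← List.sum_toFinset f hl, ← List.sum_toFinset f (nodup_strs n)]
  refine Finset.sum_le_sum_of_subset_of_nonneg (fun s hs => ?_) fun s _ _ => h0 s
  simpa using hn s (by simpa using hs)

theorem wprod_nonneg {w : List Bool → Bool → Bool → ℝ} (hw : ∀ c b b', 0 ≤ w c b b')
    (t x : List Bool) : 0 ≤ wprod w t x := Finset.prod_nonneg fun _ _ => hw _ _ _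

theorem wprod_cast (w : List Bool → Bool → Bool → ℕ) (t x : List Bool) :
    ((wprod w t x : ℕ) : ℝ) = wprod (fun c b b' => (w c b b' : ℝ)) t x := by
  simp [wprod]

theorem wprod_div (w v : List Bool → Bool → Bool → ℝ) (t x : List Bool) :
    wprod (fun c b b' => w c b b' / v c b b') t x = wprod w t x / wprod v t x := by
  simp [wprod]

theorem wprod_mul (w v : List Bool → Bool → Bool → ℝ) (t x : List Bool) :
    wprod (fun c b b' => w c b b' * v c b b') t x = wprod w t x * wprod v t x := by
  simp [wprod, Finset.prod_mul_distrib]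

theorem sum_wprod_self {R : Type*} [CommSemiring R] (n : ℕ) (w : List Bool → Bool → Bool → R)
    (hw : ∀ c, w c false false + w c true true = 1) :
    ((strs n).map fun s => wprod w s s).sum = 1 := by
  have h := sum_strs_prod (R := R) n (fun _ c b => w c b b) (fun _ => 1) (fun _ _ c _ => hw c)
  rw [Finset.prod_const_one] at h
  rw [← h]
  congr 1
  refine List.map_congr_left fun s hs => ?_
  rw [wprod, mem_strs.1 hs]

/-- The sum over `x` for a fixed `t` factors position by position. The second `t` on the right is a
dummy, since the summed weight ignores its last argument. -/
theorem sum_wprod_right {R : Type*} [CommSemiring R] (w : List Bool → Bool → Bool → R)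
    (t : List Bool) :
    ((strs t.length).map (wprod w t)).sum = wprod (fun c b _ => w c b false + w c b true) t t :=
  sum_strs_prod (R := R) t.length (fun i _ b => w (t.take i) (t.getD i false) b)
    (fun i => w (t.take i) (t.getD i false) false + w (t.take i) (t.getD i false) true)
    fun _ _ _ _ => rfl

/-- This computes the marginal of `x` when `t` is summed out. For a joint law of `t` and `x` under
which each bit of `x` is conditionally uniform, `r = 1 / 2`. -/
theorem sum_wprod_left {R : Type*} [CommSemiring R] (w : List Bool → Bool → Bool → R) (r : R)
    (hw : ∀ c b, w c false b + w c true b = r) (x : List Bool) :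
    ((strs x.length).map fun t => wprod w t x).sum = r ^ x.length := by
  have h := sum_strs_prod (R := R) x.length (fun i c b => w c b (x.getD i false)) (fun _ => r)
    (fun _ _ c _ => hw c _)
  rw [Finset.prod_const, Finset.card_range] at h
  rw [← h]
  congr 1
  refine List.map_congr_left fun s hs => ?_
  rw [wprod, mem_strs.1 hs]

/-- A string is at most as complex as it is long, up to a logarithmic term. -/
theorem condK_le_length (hU : IsOptimalPrefixMachine U) :
    ∃ c : ℕ, ∀ s t : List Bool, condK U s t ≤ s.length + 6 * Nat.size s.length + c := by
  have hS : ComputableFamily fun n _ _ _ _ s _ => decide (s.length = n) :=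
    ⟨fun h0 _ _ _ _ hs _ => computable_decide_eq (Computable.list_length.comp hs) h0⟩
  obtain ⟨c, hc⟩ := condK_le_of_enum hU hS
  refine ⟨c, fun s t => hc s.length s.length 0 0 0 s.length t s le_rfl (by omega) (by omega)
    (by omega) le_rfl (fun l hl h => ?_) ⟨0, by simp⟩⟩
  rw [← length_strs]
  exact (hl.subperm fun a ha => mem_strs.2 (by simpa using h a ha)).length_le

/-- Coding with computable conditional weights. -/
theorem prefixK_le_of_weights (hU : IsOptimalPrefixMachine U) {γ : List Bool → Bool → ℕ}
    (hγ : Computable fun z : List Bool × Bool => γ z.1 z.2) (hpos : ∀ c b, 0 < γ c b) :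
    ∃ c : ℕ, ∀ (y : ℕ → Bool) (n m M : ℕ), n ≤ M → m ≤ M →
      ∏ i ∈ Finset.range n, (γ (initSeg y i) false + γ (initSeg y i) true) ≤
        2 ^ m * ∏ i ∈ Finset.range n, γ (initSeg y i) (y i) →
      prefixK U (initSeg y n) ≤ m + 6 * Nat.size M + c := by
  set tot : List Bool → Bool → Bool → ℕ := fun c _ _ => γ c false + γ c true with htot
  set num : List Bool → Bool → Bool → ℕ := fun c b _ => γ c b with hnum
  have hnum' : Computable fun z : List Bool × Bool × Bool => num z.1 z.2.1 z.2.2 :=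
    hγ.comp (Computable.fst.pair (Computable.fst.comp Computable.snd))
  have htot' : Computable fun z : List Bool × Bool × Bool => tot z.1 z.2.1 z.2.2 :=
    computable_add (hγ.comp (Computable.fst.pair (Computable.const false)))
      (hγ.comp (Computable.fst.pair (Computable.const true)))
  have hS : ComputableFamily fun n m _ _ _ s _ =>
      decide (s.length = n) && decide (wprod tot s s ≤ 2 ^ m * wprod num s s) :=
    ⟨fun h0 h1 _ _ _ hs _ => computable_and
      (computable_decide_eq (Computable.list_length.comp hs) h0)
      (computable_decide_le (computable_wprod htot' hs hs)
        (computable_mul (computable_pow (Computable.const 2) h1) (computable_wprod hnum' hs hs)))⟩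
  obtain ⟨c, hc⟩ := condK_le_of_enum hU hS
  refine ⟨c, fun y n m M hn hm h => hc M n m 0 0 m [] (initSeg y n) hn hm (by omega)
    (by omega) hm (fun l hl h => ?_) ⟨0, ?_⟩⟩
  · have h' : ∀ s ∈ l, s.length = n ∧ wprod tot s s ≤ 2 ^ m * wprod num s s := by
      intro s hs
      simpa using h s hs
    -- Normalised weights are transition probabilities, so they sum to `1` over the strings of
    -- length `n`, and at most `2 ^ m` of these have probability at least `2 ^ (-m)`.
    have key := length_mul_le_of_sum (n := n) (A := 1) (B := 1 / 2 ^ m)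
      (f := fun s => wprod (fun c b b' => (num c b b' : ℝ) / (tot c b b' : ℝ)) s s) hl
      (fun s hs => mem_strs.2 (h' s hs).1)
      (fun s => wprod_nonneg (fun c b b' => by positivity) s s) ?_ ?_
    · rw [mul_one_div, div_le_one (by positivity)] at key
      exact_mod_cast key
    · refine (sum_wprod_self n _ fun c => ?_).le
      have := hpos c false
      have h2 : (0 : ℝ) < γ c false := by exact_mod_cast this
      simp only [hnum, htot]
      push_cast
      rw [← add_div, div_self (by positivity)]
    · intro s hs
      have h1 := (h' s hs).2
      have h2 : 0 < wprod tot s s := Finset.prod_pos fun i _ => by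
        have := hpos (s.take i) false
        simp only [htot]; omega
      rw [wprod_div, ← wprod_cast, ← wprod_cast, div_le_div_iff₀ (by positivity)
        (by exact_mod_cast h2), one_mul, mul_comm]
      exact_mod_cast h1
  · simp only [Bool.and_eq_true, decide_eq_true_eq, wprod_initSeg, htot, hnum, length_initSeg,
      true_and]
    exact h

end UpperBounds

end AlgComplexity

namespace AlgComplexity

/-! ### Conditional coding, the chain rule, and compression through simple strings -/

section ConditionalBounds

variable {U : List Bool → List Bool →. List Bool}

/-- The string with code `k`. -/
def decodeStr (k : ℕ) : List Bool := (Encodable.decode (α := List Bool) k).getD []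

theorem decodeStr_encode (s : List Bool) : decodeStr (Encodable.encode s) = s := by
  simp [decodeStr]

theorem computable_decodeStr {α : Type*} [Primcodable α] {k : α → ℕ} (hk : Computable k) :
    Computable fun a => decodeStr (k a) :=
  Computable.option_getD (Computable.decode.comp hk) (Computable.const [])

/-- Coding the selected subsequence with computable weights conditional on the selecting string. -/
theorem condK_select_le_of_weights (hU : IsOptimalPrefixMachine U) {γ : List Bool → Bool → ℕ}
    (hγ : Computable fun z : List Bool × Bool => γ z.1 z.2) (hpos : ∀ c b, 0 < γ c b) :
    ∃ c : ℕ, ∀ (x y : ℕ → Bool) (n m : ℕ),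
      (∏ i ∈ Finset.range n, bif y i then γ (initSeg y i) false + γ (initSeg y i) true else 1) ≤
        2 ^ m * ∏ i ∈ Finset.range n, (bif y i then γ (initSeg y i) (x i) else 1) →
      condK U (select (initSeg x n) (initSeg y n)) (initSeg y n) ≤ m + 6 * Nat.size m + c := by
  set tot : List Bool → Bool → Bool → ℕ :=
    fun c b _ => bif b then γ c false + γ c true else 1 with htot
  -- At an unselected position all weight is put on the bit `0`, so that summing over complete
  -- strings counts every choice of selected bits once.
  set num : List Bool → Bool → Bool → ℕ :=
    fun c b b' => bif b then γ c b' else (bif b' then 0 else 1) with hnum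
  have hb : Computable fun z : List Bool × Bool × Bool => z.2.1 :=
    Computable.fst.comp Computable.snd
  have hb' : Computable fun z : List Bool × Bool × Bool => z.2.2 :=
    Computable.snd.comp Computable.snd
  have hnum' : Computable fun z : List Bool × Bool × Bool => num z.1 z.2.1 z.2.2 :=
    Computable.cond hb (hγ.comp (Computable.fst.pair hb'))
      (Computable.cond hb' (Computable.const 0) (Computable.const 1))
  have htot' : Computable fun z : List Bool × Bool × Bool => tot z.1 z.2.1 z.2.2 :=
    Computable.cond hb (computable_add (hγ.comp (Computable.fst.pair (Computable.const false)))
      (hγ.comp (Computable.fst.pair (Computable.const true)))) (Computable.const 1)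
  have hS : ComputableFamily fun m _ _ _ t s k =>
      decide ((decodeStr k).length = t.length) && (decide (selectAt (decodeStr k) t = s) &&
        decide (wprod tot t t ≤ 2 ^ m * wprod num t (decodeStr k))) :=
    ⟨fun h0 _ _ _ ht hs hk => computable_and
      (computable_decide_eq (Computable.list_length.comp (computable_decodeStr hk))
        (Computable.list_length.comp ht)) (computable_and
      (computable_decide_eq (primrec_selectAt.to_comp.comp (computable_decodeStr hk) ht) hs)
      (computable_decide_le (computable_wprod htot' ht ht)
        (computable_mul (computable_pow (Computable.const 2) h0)
          (computable_wprod hnum' ht (computable_decodeStr hk)))))⟩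
  obtain ⟨c, hc⟩ := condK_le_of_enum hU hS
  refine ⟨c, fun x y n m h => hc m m 0 0 0 m (initSeg y n) _ le_rfl (by omega) (by omega)
    (by omega) le_rfl (fun l hl hk => ?_) ?_⟩
  · set t := initSeg y n with ht
    have h' : ∀ s ∈ l, ∃ x' : List Bool, x'.length = t.length ∧ selectAt x' t = s ∧
        wprod tot t t ≤ 2 ^ m * wprod num t x' := by
      intro s hs
      obtain ⟨k, hk⟩ := hk s hs
      exact ⟨decodeStr k, by simpa using hk⟩
    choose! f hf using h'
    have hnd : (l.map f).Nodup := hl.map_on fun a ha b hb hab => by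
      rw [← (hf a ha).2.1, ← (hf b hb).2.1, hab]
    have hT : 0 < wprod tot t t := Finset.prod_pos fun i _ => by
      have := hpos (t.take i) false
      simp only [htot]; cases t.getD i false <;> simp; omega
    have key := length_mul_le_of_sum (n := t.length) (A := ((wprod tot t t : ℕ) : ℝ))
      (B := ((wprod tot t t : ℕ) : ℝ) / 2 ^ m)
      (f := fun s => ((wprod num t s : ℕ) : ℝ)) hnd ?_ (fun s => by positivity) ?_ ?_
    · rw [List.length_map, mul_div_assoc', div_le_iff₀ (by positivity), mul_comm] at key
      have := le_of_mul_le_mul_left key (by exact_mod_cast hT)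
      exact_mod_cast this
    · simp only [List.mem_map, forall_exists_index, and_imp, forall_apply_eq_imp_iff₂]
      exact fun s hs => mem_strs.2 (hf s hs).1
    · have h1 := sum_wprod_right num t
      have h2 : wprod (fun c b _ => num c b false + num c b true) t t = wprod tot t t := by
        refine Finset.prod_congr rfl fun i _ => ?_
        simp only [hnum, htot]; cases t.getD i false <;> simp
      rw [h2] at h1
      rw [← h1, Nat.cast_list_sum, List.map_map]
      exact le_rfl
    · simp only [List.mem_map, forall_exists_index, and_imp, forall_apply_eq_imp_iff₂]
      intro s hs
      rw [div_le_iff₀ (by positivity), mul_comm]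
      exact_mod_cast (hf s hs).2.2
  · refine ⟨Encodable.encode (initSeg (fun i => x i && y i) n), ?_⟩
    rw [decodeStr_encode]
    simp only [Bool.and_eq_true, decide_eq_true_eq, length_initSeg, true_and, wprod_initSeg]
    refine ⟨?_, ?_⟩
    · rw [selectAt_eq_select (by simp)]
      exact select_initSeg_congr (fun i hi => by simp [hi]) n
    · refine h.trans_eq ?_
      congr 1
      refine Finset.prod_congr rfl fun i _ => ?_
      simp only [hnum]; cases y i <;> simp

/-- A sequence is described by the selecting sequence, the selected part and the rest. -/
theorem prefixK_le_chain (hU : IsOptimalPrefixMachine U) :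
    ∃ c : ℕ, ∀ (x y : ℕ → Bool) (n z M : ℕ), n = (initSeg y n).count true + z →
      M = prefixK U (initSeg y n) +
        condK U (select (initSeg x n) (initSeg y n)) (initSeg y n) + z →
      prefixK U (initSeg x n) ≤ M + 6 * Nat.size M + c := by
  obtain ⟨R, hR, hRU, hRm⟩ := exists_stages hU.partrec
  -- The witness `k` packs a program for the prefix of `y`, a program for the selected string, the
  -- prefix itself, and a number of steps in which both programs are seen to halt.
  let P : ℕ → List Bool := fun k => decodeStr k.unpair.1.unpair.1
  let Q : ℕ → List Bool := fun k => decodeStr k.unpair.1.unpair.2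
  let Y : ℕ → List Bool := fun k => decodeStr k.unpair.2.unpair.1
  let T : ℕ → ℕ := fun k => k.unpair.2.unpair.2
  have hP : Computable P := computable_decodeStr (Computable.fst.comp (Computable.unpair.comp
    (Computable.fst.comp Computable.unpair)))
  have hQ : Computable Q := computable_decodeStr (Computable.snd.comp (Computable.unpair.comp
    (Computable.fst.comp Computable.unpair)))
  have hY : Computable Y := computable_decodeStr (Computable.fst.comp (Computable.unpair.comp
    (Computable.snd.comp Computable.unpair)))
  have hT : Computable T := Computable.snd.comp (Computable.unpair.comp
    (Computable.snd.comp Computable.unpair))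
  have hS : ComputableFamily fun i j z _ _ s k =>
      decide ((P k).length = i) && (decide ((Q k).length = j) && (R (T k) (P k) [] (Y k) &&
        (R (T k) (Q k) (Y k) (selectAt s (Y k)) && (decide (s.length = (Y k).length) &&
          decide (s.length = (selectAt s (Y k)).length + z))))) := by
    refine ⟨fun h0 h1 h2 _ _ hs hk => ?_⟩
    have hsel := primrec_selectAt.to_comp.comp hs (hY.comp hk)
    refine computable_and (computable_decide_eq (Computable.list_length.comp (hP.comp hk)) h0) ?_
    refine computable_and (computable_decide_eq (Computable.list_length.comp (hQ.comp hk)) h1) ?_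
    refine computable_and (hR.to_comp.comp (((hT.comp hk).pair (hP.comp hk)).pair
      ((Computable.const []).pair (hY.comp hk)))) ?_
    refine computable_and (hR.to_comp.comp (((hT.comp hk).pair (hQ.comp hk)).pair
      ((hY.comp hk).pair hsel))) ?_
    exact computable_and (computable_decide_eq (Computable.list_length.comp hs)
      (Computable.list_length.comp (hY.comp hk))) (computable_decide_eq
      (Computable.list_length.comp hs) (computable_add (Computable.list_length.comp hsel) h2))
  obtain ⟨c, hc⟩ := condK_le_of_enum hU hS
  refine ⟨c, fun x y n z M hz hM => hc M (prefixK U (initSeg y n))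
    (condK U (select (initSeg x n) (initSeg y n)) (initSeg y n)) z 0 M [] _ (by omega) (by omega)
    (by omega) (by omega) le_rfl (fun l hl hk => ?_) ?_⟩
  · simp only [Bool.and_eq_true, decide_eq_true_eq] at hk
    choose! k hk using hk
    set i := prefixK U (initSeg y n)
    set j := condK U (select (initSeg x n) (initSeg y n)) (initSeg y n)
    -- The two programs and the unselected bits determine `s`: the first program yields the prefix
    -- of `y`, the second then yields the selected bits. Counting triples of lengths `i`, `j`, `z`
    -- gives `2 ^ M`.
    let F : List Bool → List Bool × List Bool × List Bool :=
      fun s => (P (k s), Q (k s), select s ((Y (k s)).map not))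
    have hcard := Finset.card_le_card_of_injOn (s := l.toFinset)
      (t := (strs i).toFinset ×ˢ (strs j).toFinset ×ˢ (strs z).toFinset) F ?_ ?_
    · rw [Finset.card_product, Finset.card_product, List.toFinset_card_of_nodup hl,
        List.toFinset_card_of_nodup (nodup_strs _), List.toFinset_card_of_nodup (nodup_strs _),
        List.toFinset_card_of_nodup (nodup_strs _), length_strs, length_strs, length_strs,
        ← pow_add, ← pow_add, ← add_assoc, ← hM] at hcard
      exact hcard
    · intro s hs
      have hs : s ∈ l := by simpa using hs
      obtain ⟨h1, h2, -, -, h3, h4⟩ := hk s hs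
      rw [selectAt_eq_select h3, length_select h3] at h4
      have h5 : (select s ((Y (k s)).map not)).length = z := by
        rw [length_select (by simpa using h3)]
        have e1 : ((Y (k s)).map not).count true = (Y (k s)).count false := by
          simpa using List.count_map_of_injective (Y (k s)) not Bool.not_injective false
        have e2 := List.count_true_add_count_false (Y (k s))
        omega
      simp [F, mem_strs, h1, h2, h5]
    · intro s hs s' hs' hF
      have hs : s ∈ l := by simpa using hs
      have hs' : s' ∈ l := by simpa using hs'
      obtain ⟨-, -, a1, a2, a3, -⟩ := hk s hs
      obtain ⟨-, -, b1, b2, b3, -⟩ := hk s' hs'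
      simp only [F, Prod.mk.injEq] at hF
      obtain ⟨e1, e2, e3⟩ := hF
      have eY : Y (k s) = Y (k s') := Part.mem_unique ((hRU _ _ _).2 ⟨_, a1⟩)
        (e1 ▸ (hRU _ _ _).2 ⟨_, b1⟩)
      have eS : selectAt s (Y (k s)) = selectAt s' (Y (k s')) :=
        Part.mem_unique ((hRU _ _ _).2 ⟨_, a2⟩) (by
          rw [e2, eY]; exact (hRU _ _ _).2 ⟨_, b2⟩)
      rw [selectAt_eq_select a3, selectAt_eq_select b3] at eS
      rw [← eY] at eS e3 b3
      exact eq_of_select_eq a3 b3 eS e3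
  · obtain ⟨p, hp, hpl⟩ := exists_program hU (initSeg y n) []
    obtain ⟨q, hq, hql⟩ := exists_program hU (select (initSeg x n) (initSeg y n)) (initSeg y n)
    obtain ⟨k1, h1⟩ := (hRU _ _ _).1 hp
    obtain ⟨k2, h2⟩ := (hRU _ _ _).1 hq
    refine ⟨Nat.pair (Nat.pair (Encodable.encode p) (Encodable.encode q))
      (Nat.pair (Encodable.encode (initSeg y n)) (max k1 k2)), ?_⟩
    have h1 := hRm _ (max k1 k2) _ _ _ (le_max_left _ _) h1
    have h2 := hRm _ (max k1 k2) _ _ _ (le_max_right _ _) h2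
    have hsel := selectAt_eq_select (s := initSeg x n) (t := initSeg y n) (by simp)
    have hlen := length_select (s := initSeg x n) (t := initSeg y n) (by simp)
    simp only [P, Q, Y, T, Nat.unpair_pair, decodeStr_encode, hsel, Bool.and_eq_true,
      decide_eq_true_eq, length_initSeg, true_and]
    exact ⟨hpl, hql, h1, h2, by omega⟩

theorem card_filter_prefixK_lt (hU : IsOptimalPrefixMachine U) (A : Finset (List Bool)) (l : ℕ) :
    (A.filter fun x => prefixK U x < l).card ≤ 2 ^ l := by
  choose p hp hpl using fun x => exists_program hU x []
  have h := Finset.card_le_card_of_injOn (s := A.filter fun x => prefixK U x < l)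
    (t := (Finset.range l).biUnion fun a => (strs a).toFinset) p ?_ ?_
  · refine h.trans (Finset.card_biUnion_le.trans ?_)
    have e : ∀ l : ℕ, ∑ a ∈ Finset.range l, (strs a).toFinset.card + 1 = 2 ^ l := by
      intro l
      induction l with
      | zero => rfl
      | succ l ih =>
        rw [Finset.sum_range_succ, List.toFinset_card_of_nodup (nodup_strs l), length_strs, pow_succ]
        omega
    have := e l
    omega
  · intro x hx
    have hx := (Finset.mem_filter.1 hx).2
    simp only [Finset.coe_biUnion, Set.mem_iUnion, Finset.mem_coe, Finset.mem_range,
      List.mem_toFinset]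
    exact ⟨_, (hpl x).trans_lt hx, mem_strs.2 rfl⟩
  · intro x _ x' _ hxx
    exact Part.mem_unique (hp x) (hxx ▸ hp x')

/-- Low complexity is semidecidable: run all programs shorter than `l` for `k` steps. A positive
answer persists at later stages, so finitely many strings can share one stage. -/
theorem exists_lt_stages (hU : IsOptimalPrefixMachine U) :
    ∃ found : ℕ → ℕ → List Bool → Bool,
      (Computable fun z : (ℕ × ℕ) × List Bool => found z.1.1 z.1.2 z.2) ∧
      (∀ k l x, found k l x = true → prefixK U x < l) ∧
      ∀ l x, prefixK U x < l → ∃ k, ∀ k' ≥ k, found k' l x = true := by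
  obtain ⟨R, hR, hRU, hRm⟩ := exists_stages hU.partrec
  have h1 : PrimrecRel fun (p : List Bool) (b : ℕ × List Bool) => R b.1 p [] b.2 = true :=
    Primrec.eq.comp (hR.comp (Primrec.pair (Primrec.pair (Primrec.fst.comp Primrec.snd)
      Primrec.fst) (Primrec.pair (Primrec.const []) (Primrec.snd.comp Primrec.snd))))
      (Primrec.const true)
  have h2 : PrimrecRel fun (a : ℕ) (b : ℕ × List Bool) => ∃ p ∈ strs a, R b.1 p [] b.2 = true :=
    h1.exists_mem_list.comp (primrec_strs.comp Primrec.fst) Primrec.snd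
  have h3 : PrimrecPred fun z : (ℕ × ℕ) × List Bool =>
      ∃ a ∈ List.range z.1.2, ∃ p ∈ strs a, R z.1.1 p [] z.2 = true :=
    PrimrecRel.comp h2.exists_mem_list
      (Primrec.list_range.comp (Primrec.snd.comp Primrec.fst))
      (Primrec.pair (Primrec.fst.comp Primrec.fst) Primrec.snd)
  classical
  refine ⟨fun k l x => decide (∃ a ∈ List.range l, ∃ p ∈ strs a, R k p [] x = true),
    h3.decide.to_comp, fun k l x h => ?_, fun l x h => ?_⟩
  · obtain ⟨a, ha, p, hp, h⟩ := of_decide_eq_true h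
    have := condK_le ((hRU _ _ _).2 ⟨k, h⟩)
    rw [mem_strs.1 hp] at this
    exact this.trans_lt (List.mem_range.1 ha)
  · obtain ⟨p, hp, hpl⟩ := exists_program hU x []
    obtain ⟨k, hk⟩ := (hRU _ _ _).1 hp
    exact ⟨k, fun k' hk' => decide_eq_true
      ⟨_, List.mem_range.2 (hpl ▸ h), p, mem_strs.2 rfl, hRm _ _ _ _ _ hk' hk⟩⟩

/-- Let `κ` be a transition from `y` to `x` under which `x` is uniform if `y` has the
distribution given by the weights `γ`. If the strings of complexity less than `l` have conditional
probability at least `2 ^ (-r)` given `y`, then the code length `m` of `y` can be reduced by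
`n - l - r`. -/
theorem prefixK_le_of_simple_strings (hU : IsOptimalPrefixMachine U) {γ : List Bool → Bool → ℕ}
    (hγ : Computable fun z : List Bool × Bool => γ z.1 z.2) (hpos : ∀ c b, 0 < γ c b)
    {κ : List Bool → Bool → Bool → ℕ} {D : List Bool → ℕ}
    (hκ : Computable fun z : List Bool × Bool × Bool => κ z.1 z.2.1 z.2.2) (hD : Computable D)
    (hDpos : ∀ c, 0 < D c)
    (hunif : ∀ c b, 2 * (γ c false * κ c false b + γ c true * κ c true b) =
      (γ c false + γ c true) * D c) :
    ∃ c : ℕ, ∀ (y : ℕ → Bool) (n l r m M : ℕ), n ≤ M → l ≤ M → r ≤ M → m ≤ M → m + r + l ≤ M →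
      ∏ i ∈ Finset.range n, (γ (initSeg y i) false + γ (initSeg y i) true) ≤
        2 ^ m * ∏ i ∈ Finset.range n, γ (initSeg y i) (y i) →
      ∏ i ∈ Finset.range n, D (initSeg y i) ≤ 2 ^ r * ((strs n).map fun x =>
        if prefixK U x < l then wprod κ (initSeg y n) x else 0).sum →
      prefixK U (initSeg y n) + n ≤ m + r + l + 6 * Nat.size M + c := by
  classical
  obtain ⟨found, hfound, found_lt, lt_found⟩ := exists_lt_stages hU
  set tot : List Bool → Bool → Bool → ℕ := fun c _ _ => γ c false + γ c true with htot
  set num : List Bool → Bool → Bool → ℕ := fun c b _ => γ c b with hnum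
  set den : List Bool → Bool → Bool → ℕ := fun c _ _ => D c with hden
  have hnum' : Computable fun z : List Bool × Bool × Bool => num z.1 z.2.1 z.2.2 :=
    hγ.comp (Computable.fst.pair (Computable.fst.comp Computable.snd))
  have htot' : Computable fun z : List Bool × Bool × Bool => tot z.1 z.2.1 z.2.2 :=
    computable_add (hγ.comp (Computable.fst.pair (Computable.const false)))
      (hγ.comp (Computable.fst.pair (Computable.const true)))
  have hden' : Computable fun z : List Bool × Bool × Bool => den z.1 z.2.1 z.2.2 :=
    hD.comp Computable.fst
  have hS : ComputableFamily fun n l r m _ s k =>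
      decide (s.length = n) && (decide (wprod tot s s ≤ 2 ^ m * wprod num s s) &&
        decide (wprod den s s ≤ 2 ^ r *
          ((strs n).map fun x => bif found k l x then wprod κ s x else 0).sum)) := by
    refine ⟨fun h0 h1 h2 h3 _ hs hk => computable_and
      (computable_decide_eq (Computable.list_length.comp hs) h0) (computable_and
      (computable_decide_le (computable_wprod htot' hs hs)
        (computable_mul (computable_pow (Computable.const 2) h3) (computable_wprod hnum' hs hs)))
      (computable_decide_le (computable_wprod hden' hs hs)
        (computable_mul (computable_pow (Computable.const 2) h2) (computable_list_sum
          (primrec_strs.to_comp.comp h0) ?_))))⟩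
    exact Computable.cond (hfound.comp (((hk.comp Computable.fst).pair
      (h1.comp Computable.fst)).pair Computable.snd))
      (computable_wprod hκ (hs.comp Computable.fst) Computable.snd) (Computable.const 0)
  obtain ⟨c, hc⟩ := condK_le_of_enum hU hS
  refine ⟨c, fun y n l r m M hn hl hr hm hM h1 h2 => ?_⟩
  set A := (strs n).toFinset with hA
  have hcount := card_filter_prefixK_lt hU A l
  -- The sum over `s` of its `γ`-probability times the conditional mass of the simple strings is
  -- their uniform mass, at most `2 ^ l / 2 ^ n`. Each `s` in `L` contributes at least `2 ^ (-m) * 2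
  -- ^ (-r)`.
  have key : ∀ L : List (List Bool), L.Nodup → (∀ s ∈ L, s.length = n ∧
      wprod tot s s ≤ 2 ^ m * wprod num s s ∧ wprod den s s ≤ 2 ^ r *
        ((strs n).map fun x => if prefixK U x < l then wprod κ s x else 0).sum) →
      L.length * 2 ^ n ≤ 2 ^ (m + r + l) := by
    intro L hL hs
    set q : List Bool → Bool → Bool → ℝ := fun c b b' => (num c b b' : ℝ) / (tot c b b' : ℝ)
    set C : List Bool → Bool → Bool → ℝ := fun c b b' => (κ c b b' : ℝ) / (den c b b' : ℝ)
    have hq : ∀ c b b', 0 ≤ q c b b' := fun c b b' => by positivity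
    have hC : ∀ c b b', 0 ≤ C c b b' := fun c b b' => by positivity
    have h3 := length_mul_le_of_sum (n := n) (A := 2 ^ r * (2 ^ l * (1 / 2) ^ n)) (B := 1 / 2 ^ m)
      (f := fun s => wprod q s s * (2 ^ r * ∑ x ∈ A with prefixK U x < l, wprod C s x)) hL
      (fun s h => mem_strs.2 (hs s h).1) (fun s => mul_nonneg (wprod_nonneg hq _ _)
        (mul_nonneg (by positivity) (Finset.sum_nonneg fun x _ => wprod_nonneg hC _ _))) ?_ ?_
    · rw [mul_one_div, div_le_iff₀ (by positivity), one_div, inv_pow] at h3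
      have h4 : (L.length : ℝ) * 2 ^ n ≤ 2 ^ (m + r + l) := by
        calc (L.length : ℝ) * 2 ^ n ≤ 2 ^ r * (2 ^ l * (2 ^ n)⁻¹) * 2 ^ m * 2 ^ n := by gcongr
          _ = 2 ^ (m + r + l) := by rw [pow_add, pow_add]; field_simp
      exact_mod_cast h4
    · rw [← List.sum_toFinset _ (nodup_strs n), ← hA]
      calc ∑ s ∈ A, wprod q s s * (2 ^ r * ∑ x ∈ A with prefixK U x < l, wprod C s x)
          = 2 ^ r * ∑ x ∈ A with prefixK U x < l, ∑ s ∈ A,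
              wprod (fun c b b' => q c b b' * C c b b') s x := by
            rw [Finset.sum_comm, Finset.mul_sum]
            refine Finset.sum_congr rfl fun s _ => ?_
            rw [mul_left_comm, Finset.mul_sum]
            congr 1
            exact Finset.sum_congr rfl fun x _ => (wprod_mul q C s x).symm
        _ = 2 ^ r * ∑ x ∈ A with prefixK U x < l, (1 / 2 : ℝ) ^ n := by
            congr 1
            refine Finset.sum_congr rfl fun x hx => ?_
            have hx : x.length = n := by simpa [hA, mem_strs] using (Finset.mem_filter.1 hx).1
            rw [hA, List.sum_toFinset _ (nodup_strs n), ← hx]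
            refine sum_wprod_left _ _ (fun c b => ?_) x
            have g1 : (0 : ℝ) < γ c false + γ c true := by
              exact_mod_cast Nat.add_pos_left (hpos c false) _
            have g2 : (0 : ℝ) < D c := by exact_mod_cast hDpos c
            have g3 : 2 * ((γ c false : ℝ) * κ c false b + γ c true * κ c true b) =
                (γ c false + γ c true) * D c := by exact_mod_cast hunif c b
            simp only [q, C, hnum, htot, hden]
            push_cast
            field_simp
            linarith
        _ ≤ 2 ^ r * (2 ^ l * (1 / 2) ^ n) := by
            rw [Finset.sum_const, nsmul_eq_mul]
            gcongr
            exact_mod_cast hcount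
    · intro s h
      obtain ⟨g1, g2, g3⟩ := hs s h
      have p1 : 0 < wprod tot s s := Finset.prod_pos fun i _ => by
        have := hpos (s.take i) false
        simp only [htot]; omega
      have p2 : 0 < wprod den s s := Finset.prod_pos fun i _ => hDpos _
      have p1' : (0 : ℝ) < wprod (fun c b b' => (tot c b b' : ℝ)) s s := by
        rw [← wprod_cast]; exact_mod_cast p1
      have p2' : (0 : ℝ) < wprod (fun c b b' => (den c b b' : ℝ)) s s := by
        rw [← wprod_cast]; exact_mod_cast p2
      have e1 : 1 / 2 ^ m ≤ wprod q s s := by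
        rw [wprod_div, div_le_div_iff₀ (by positivity) p1', one_mul, mul_comm, ← wprod_cast,
          ← wprod_cast]
        exact_mod_cast g2
      have e2 : 1 ≤ 2 ^ r * ∑ x ∈ A with prefixK U x < l, wprod C s x := by
        have e3 : ∀ x, wprod C s x = (wprod κ s x : ℕ) / wprod (fun c b b' => (den c b b' : ℝ)) s s :=
          fun x => by rw [wprod_div, wprod_cast]; rfl
        simp_rw [e3]
        rw [← Finset.sum_div, mul_div_assoc', le_div_iff₀ p2', one_mul, ← wprod_cast]
        rw [← List.sum_toFinset _ (nodup_strs n), ← Finset.sum_filter] at g3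
        exact_mod_cast g3
      calc 1 / 2 ^ m = 1 / 2 ^ m * 1 := (mul_one _).symm
        _ ≤ _ := mul_le_mul e1 e2 zero_le_one (wprod_nonneg hq _ _)
  have hmem : wprod tot (initSeg y n) (initSeg y n) ≤
      2 ^ m * wprod num (initSeg y n) (initSeg y n) ∧
      wprod den (initSeg y n) (initSeg y n) ≤ 2 ^ r *
        ((strs n).map fun x => if prefixK U x < l then wprod κ (initSeg y n) x else 0).sum := by
    rw [wprod_initSeg, wprod_initSeg, wprod_initSeg]
    exact ⟨h1, h2⟩
  -- The count applied to the single prefix of `y` shows that the subtraction `m + r + l - n` below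
  -- is not truncated.
  have hle : n ≤ m + r + l := by
    have := key [initSeg y n] (List.nodup_singleton _) (by simpa using hmem)
    rw [List.length_singleton, one_mul] at this
    exact (Nat.pow_le_pow_iff_right (by norm_num)).1 this
  have := hc M n l r m (m + r + l - n) [] (initSeg y n) hn hl hr hm (by omega) ?_ ?_
  · unfold prefixK; omega
  · intro L hL hk
    -- Every string found at a stage is truly simple, so the staged sum bounds the true one from
    -- below and the count applies to all enumerated `s`.
    have h3 := key L hL fun s hs => by
      obtain ⟨k, hk⟩ := hk s hs
      simp only [Bool.and_eq_true, decide_eq_true_eq] at hk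
      refine ⟨hk.1, hk.2.1, hk.2.2.trans (Nat.mul_le_mul_left _ (List.sum_le_sum fun x _ => ?_))⟩
      rcases hf : found k l x with _ | _
      · simp
      · simp [found_lt _ _ _ hf]
    refine le_of_mul_le_mul_right ?_ (pow_pos (zero_lt_two' ℕ) n)
    rwa [← pow_add, Nat.sub_add_cancel hle]
  · have h4 : ∀ x, ∃ k, ∀ k' ≥ k, prefixK U x < l → found k' l x = true := by
      intro x
      by_cases hx : prefixK U x < l
      · obtain ⟨k, hk⟩ := lt_found l x hx
        exact ⟨k, fun k' h _ => hk k' h⟩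
      · exact ⟨0, fun _ _ h => absurd h hx⟩
    choose K hK using h4
    -- One stage late enough to find all simple strings of length `n`.
    refine ⟨(strs n).toFinset.sup K, ?_⟩
    simp only [Bool.and_eq_true, decide_eq_true_eq, length_initSeg, true_and]
    refine ⟨hmem.1, hmem.2.trans (Nat.mul_le_mul_left _ (List.sum_le_sum fun x hx => ?_))⟩
    split_ifs with hlt
    · rw [hK x _ (Finset.le_sup (List.mem_toFinset.2 hx)) hlt]; simp
    · simp

end ConditionalBounds

end AlgComplexity

namespace AlgComplexity

/-! ### Logarithmic error terms are negligible -/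

section Asymptotics

theorem size_le_logb {m : ℕ} (hm : 0 < m) : (Nat.size m : ℝ) ≤ 1 + Real.logb 2 m := by
  have h1 : 0 < Nat.size m := Nat.size_pos.2 hm
  have h2 : 2 ^ (Nat.size m - 1) ≤ m := Nat.lt_size.1 (by omega)
  have h3 : (2 : ℝ) ^ (Nat.size m - 1) ≤ m := by exact_mod_cast h2
  have h4 := Real.logb_le_logb_of_le (b := 2) (by norm_num) (by positivity) h3
  rw [Real.logb_pow, Real.logb_self_eq_one (by norm_num), mul_one, Nat.cast_sub h1] at h4
  push_cast at h4
  linarith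

theorem tendsto_log_linear_div (C : ℕ) :
    Tendsto (fun n : ℕ => Real.log ((C + 1) * n + (C + 1)) / n) atTop (𝓝 0) := by
  have h1 : Tendsto (fun n : ℕ => ((C : ℝ) + 1) * n + (C + 1)) atTop atTop :=
    tendsto_atTop_add_const_right _ _
      (tendsto_natCast_atTop_atTop.const_mul_atTop (by positivity))
  have h2 : Tendsto (fun x : ℝ => Real.log x / x) atTop (𝓝 0) := by
    simpa using Real.isLittleO_log_id_atTop.tendsto_div_nhds_zero
  have h3 : Tendsto (fun n : ℕ => ((C : ℝ) + 1) + (C + 1) / n) atTop (𝓝 ((C + 1) + 0)) :=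
    tendsto_const_nhds.add (tendsto_const_div_atTop_nhds_zero_nat _)
  have h4 := (h2.comp h1).mul h3
  rw [zero_mul] at h4
  refine h4.congr' ?_
  filter_upwards [eventually_gt_atTop 0] with n hn
  have : (0 : ℝ) < n := by exact_mod_cast hn
  simp only [Function.comp_apply]
  field_simp

theorem tendsto_size_div (C : ℕ) :
    Tendsto (fun n : ℕ => (Nat.size (C * n + C) : ℝ) / n) atTop (𝓝 0) := by
  have h1 : Tendsto (fun n : ℕ => 1 / (n : ℝ) +
      Real.log ((C + 1) * n + (C + 1)) / n / Real.log 2) atTop (𝓝 (0 + 0 / Real.log 2)) :=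
    (tendsto_const_div_atTop_nhds_zero_nat 1).add ((tendsto_log_linear_div C).div_const _)
  rw [zero_div, zero_add] at h1
  refine squeeze_zero (fun n => by positivity) (fun n => ?_) h1
  -- Passing to `C + 1` keeps the argument of the logarithm positive when `C = 0`.
  have h2 : Nat.size (C * n + C) ≤ Nat.size ((C + 1) * n + (C + 1)) :=
    Nat.size_le_size (by nlinarith)
  have h3 := size_le_logb (m := (C + 1) * n + (C + 1)) (by omega)
  have h4 : (Nat.size (C * n + C) : ℝ) ≤ Nat.size ((C + 1) * n + (C + 1)) := by exact_mod_cast h2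
  rw [div_right_comm, ← add_div]
  refine div_le_div_of_nonneg_right (h4.trans (h3.trans_eq ?_)) (Nat.cast_nonneg n)
  rw [Real.logb]
  push_cast
  rfl

/-- Every coding bound has an error `6 * Nat.size M + c`; it is `o(n)` once `M` is at most linear in
`n`. -/
theorem tendsto_slack (C c : ℕ) :
    Tendsto (fun n : ℕ => (6 * (Nat.size (C * n + C) : ℝ) + c) / n) atTop (𝓝 0) := by
  have h := ((tendsto_size_div C).const_mul 6).add (tendsto_const_div_atTop_nhds_zero_nat (c : ℝ))
  rw [mul_zero, add_zero] at h
  exact h.congr fun n => by rw [add_div, mul_div_assoc]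

theorem eventually_slack_le (C c : ℕ) {ε : ℝ} (hε : 0 < ε) :
    ∀ᶠ n : ℕ in atTop, 6 * (Nat.size (C * n + C) : ℝ) + c ≤ ε * n := by
  filter_upwards [(tendsto_slack C c).eventually_lt_const hε, eventually_gt_atTop 0] with n h hn
  have hn : (0 : ℝ) < n := by exact_mod_cast hn
  exact ((div_lt_iff₀ hn).1 h).le

theorem size_le_self (n : ℕ) : Nat.size n ≤ n := Nat.size_le.2 n.lt_two_pow_self

end Asymptotics

/-! ### Rate zero implies that selection preserves incompressibility -/

section Forward

variable {U : List Bool → List Bool →. List Bool}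

theorem tendsto_condK_select (hU : IsOptimalPrefixMachine U) {y x : ℕ → Bool} {d : ℝ} (hd : 0 < d)
    (hdens : Tendsto (fun n : ℕ => ((initSeg y n).count true : ℝ) / n) atTop (𝓝 d))
    (hy : Tendsto (fun n : ℕ => (prefixK U (initSeg y n) : ℝ) / n) atTop (𝓝 0))
    (hx : Tendsto (fun n : ℕ => (prefixK U (initSeg x n) : ℝ) / n) atTop (𝓝 1)) :
    Tendsto (fun n : ℕ => (condK U (select (initSeg x n) (initSeg y n)) (initSeg y n) : ℝ) /
      (select (initSeg x n) (initSeg y n)).length) atTop (𝓝 1) := by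
  obtain ⟨c, hc⟩ := condK_le_length hU
  obtain ⟨c', hc'⟩ := prefixK_le_chain hU
  have hlen : ∀ n, (select (initSeg x n) (initSeg y n)).length = (initSeg y n).count true :=
    fun n => length_select (by simp)
  have hcnt : ∀ n, (initSeg y n).count true ≤ n := fun n =>
    List.count_le_length.trans_eq (length_initSeg y n)
  simp_rw [hlen]
  set A : ℕ → ℕ := fun n => condK U (select (initSeg x n) (initSeg y n)) (initSeg y n) with hA
  set N : ℕ → ℕ := fun n => (initSeg y n).count true with hN
  have hAle : ∀ n, A n ≤ N n + 6 * Nat.size (N n) + c := fun n => by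
    have := hc (select (initSeg x n) (initSeg y n)) (initSeg y n)
    rwa [hlen] at this
  -- Both `K(y)` and the selected part are crudely at most `7 * n + c`, and `z ≤ n`. The total `15 *
  -- n + 2 * c` is below `C * n + C`.
  set C := 15 + 2 * c with hC
  have hupper : ∀ n, (A n : ℝ) ≤ N n + (6 * (Nat.size (C * n + C) : ℝ) + c) := fun n => by
    have h2 : Nat.size (N n) ≤ Nat.size (C * n + C) :=
      Nat.size_le_size ((hcnt n).trans (by rw [hC]; nlinarith))
    have := hAle n
    have h3 : A n ≤ N n + (6 * Nat.size (C * n + C) + c) := by omega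
    exact_mod_cast h3
  have hlower : ∀ n, (prefixK U (initSeg x n) : ℝ) ≤ prefixK U (initSeg y n) + A n + (n - N n) +
      (6 * (Nat.size (C * n + C) : ℝ) + c') := fun n => by
    obtain ⟨z, hz⟩ := Nat.exists_eq_add_of_le (hcnt n)
    have h1 := hc' x y n z _ hz rfl
    have h2 : prefixK U (initSeg y n) + A n + z ≤ C * n + C := by
      have h3 := hc (initSeg y n) []
      rw [length_initSeg] at h3
      have h4 := hAle n
      have h5 := size_le_self n
      have h6 := size_le_self (N n)
      have h7 := hcnt n
      have h8 : 0 ≤ 2 * c * n := Nat.zero_le _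
      unfold prefixK
      rw [hC]
      simp only [hN] at *
      nlinarith
    have h3 := Nat.size_le_size h2
    have h4 : prefixK U (initSeg x n) ≤ prefixK U (initSeg y n) + A n + z +
        (6 * Nat.size (C * n + C) + c') := by simp only [hA] at *; omega
    have h5 : (n : ℝ) - N n = z := by
      have : (n : ℝ) = N n + z := by exact_mod_cast hz
      linarith
    rw [h5]
    exact_mod_cast h4
  -- This is the chain rule solved for the selected part and divided by `N n`, written in quotients
  -- by `n` whose limits are known. The positive density `d` permits the division.
  have hlow : Tendsto (fun n : ℕ => 1 - ((1 - (prefixK U (initSeg x n) : ℝ) / n) +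
      (prefixK U (initSeg y n) : ℝ) / n + (6 * (Nat.size (C * n + C) : ℝ) + c') / n) /
      ((N n : ℝ) / n)) atTop (𝓝 1) := by
    have := ((((tendsto_const_nhds (x := (1 : ℝ))).sub hx).add hy).add (tendsto_slack C c')).div
      hdens hd.ne'
    simpa using (tendsto_const_nhds (x := (1 : ℝ))).sub this
  have hup : Tendsto (fun n : ℕ => 1 + (6 * (Nat.size (C * n + C) : ℝ) + c) / n / ((N n : ℝ) / n))
      atTop (𝓝 1) := by
    have := (tendsto_slack C c).div hdens hd.ne'
    simpa using (tendsto_const_nhds (x := (1 : ℝ))).add this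
  refine tendsto_of_tendsto_of_tendsto_of_le_of_le' hlow hup ?_ ?_
  all_goals
    filter_upwards [hdens.eventually_const_lt hd, eventually_gt_atTop 0] with n h hn
    have hn : (0 : ℝ) < n := by exact_mod_cast hn
    have hNn : (0 : ℝ) < N n := (div_pos_iff_of_pos_right hn).1 h
  · have := hlower n
    rw [← sub_nonneg]
    have e : (A n : ℝ) / N n - (1 - ((1 - (prefixK U (initSeg x n) : ℝ) / n) +
        (prefixK U (initSeg y n) : ℝ) / n + (6 * (Nat.size (C * n + C) : ℝ) + c') / n) /
        ((N n : ℝ) / n)) = (prefixK U (initSeg y n) + A n + (n - N n) +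
        (6 * (Nat.size (C * n + C) : ℝ) + c') - prefixK U (initSeg x n)) / N n := by
      field_simp
      ring
    rw [e]
    exact div_nonneg (by linarith) hNn.le
  · have := hupper n
    have e : 1 + (6 * (Nat.size (C * n + C) : ℝ) + c) / n / ((N n : ℝ) / n) =
        (N n + (6 * (Nat.size (C * n + C) : ℝ) + c)) / N n := by
      field_simp
    rw [e]
    gcongr

end Forward

/-! ### Computable weights dominating a computable measure -/

section ComputableMeasure

theorem measurableSet_cylinder (s : List Bool) : MeasurableSet (cylinder s) := by
  have e : cylinder s = ⋂ i ∈ Finset.range s.length, {ω : ℕ → Bool | ω i = s.getD i false} := by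
    ext ω
    simp only [cylinder, Set.mem_ofPred_eq, Set.mem_iInter, Finset.mem_range]
    constructor
    · intro h i hi
      rw [← h, getD_initSeg ω (by simpa [h] using hi)]
    · intro h
      refine List.ext_getElem (by simp) fun i h1 h2 => ?_
      have := h i h2
      simp only [initSeg, List.getElem_map, List.getElem_range]
      rw [this]; simp [List.getD, h2]
  rw [e]
  refine Finset.measurableSet_biInter _ fun i _ => ?_
  exact (measurable_pi_apply i) (measurableSet_singleton _)

theorem measureReal_cylinder_add (P : Measure (ℕ → Bool)) [IsProbabilityMeasure P] (s : List Bool) :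
    P.real (cylinder (s ++ [false])) + P.real (cylinder (s ++ [true])) = P.real (cylinder s) := by
  rw [← measureReal_union ?_ (measurableSet_cylinder _)]
  · congr 1
    ext ω
    simp only [cylinder, Set.mem_union, Set.mem_ofPred_eq, List.length_append, List.length_singleton,
      initSeg_succ]
    constructor
    · rintro (h | h) <;> exact (List.append_inj' h rfl).1
    · intro h
      rw [h]
      cases ω s.length <;> simp
  · rw [Set.disjoint_left]
    intro ω h1 h2
    simp only [cylinder, Set.mem_ofPred_eq, List.length_append, List.length_singleton] at h1 h2
    rw [h1] at h2
    simp at h2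

/-- A computable probability is dominated, up to a polynomial factor, by one with computable
positive rational transition probabilities. -/
theorem exists_weights {P : Measure (ℕ → Bool)} [IsProbabilityMeasure P]
    (hPc : IsComputableProb P) : ∃ γ : List Bool → Bool → ℕ,
      (Computable fun z : List Bool × Bool => γ z.1 z.2) ∧ (∀ c b, 0 < γ c b) ∧
      ∀ (y : ℕ → Bool) (n : ℕ), P.real (cylinder (initSeg y n)) *
        ∏ i ∈ Finset.range n, ((γ (initSeg y i) false : ℝ) + γ (initSeg y i) true) ≤
        3 * (n + 1) * ∏ i ∈ Finset.range n, (γ (initSeg y i) (y i) : ℝ) := by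
  obtain ⟨A, hnum, hden, hA⟩ := hPc
  let N : List Bool → ℕ := fun s => (A s (4 ^ (s.length + 1))).num
  let E : List Bool → ℕ := fun s => (A s (4 ^ (s.length + 1))).den
  -- Adding the uniform measure keeps `a` away from zero, and the accuracy `4 ^ (-(|s| + 1))` is
  -- small even relative to this uniform part.
  let a : List Bool → ℝ := fun s => (A s (4 ^ (s.length + 1)) : ℝ) + 1 / 2 ^ s.length
  have hEpos : ∀ s, 0 < E s := fun s => NNRat.den_pos _
  have hk : Computable fun s : List Bool => 4 ^ (s.length + 1) :=
    computable_pow (Computable.const 4) (Computable.succ.comp Computable.list_length)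
  have hN : Computable N := hnum.comp Computable.id hk
  have hE : Computable E := hden.comp Computable.id hk
  -- These are the two values of `a` on the children of `c`, brought to a common denominator and
  -- cleared.
  let γ : List Bool → Bool → ℕ := fun c b =>
    (N (c ++ [b]) * 2 ^ (c.length + 1) + E (c ++ [b])) * E (c ++ [!b])
  have hγ : Computable fun z : List Bool × Bool => γ z.1 z.2 := by
    have h1 : Computable fun z : List Bool × Bool => z.1 ++ [z.2] := Computable.list_concat
    have h2 : Computable fun z : List Bool × Bool => z.1 ++ [!z.2] :=
      Computable.list_concat.comp Computable.fst (Primrec.not.to_comp.comp Computable.snd)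
    exact computable_mul (computable_add (computable_mul (hN.comp h1)
      (computable_pow (Computable.const 2) (Computable.succ.comp
        (Computable.list_length.comp Computable.fst)))) (hE.comp h1)) (hE.comp h2)
  have hpos : ∀ c b, 0 < γ c b := fun c b =>
    Nat.mul_pos (Nat.add_pos_right _ (hEpos _)) (hEpos _)
  have hapos : ∀ s, 1 / 2 ^ s.length ≤ a s := fun s => by
    have : (0 : ℝ) ≤ (A s (4 ^ (s.length + 1)) : ℝ) := by positivity
    simp only [a]; linarith
  have hscale : ∀ c b, (γ c b : ℝ) =
      a (c ++ [b]) * (2 ^ (c.length + 1) * E (c ++ [false]) * E (c ++ [true])) := by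
    intro c b
    have e1 : ((A (c ++ [b]) (4 ^ ((c ++ [b]).length + 1)) : ℚ≥0) : ℝ) =
        (N (c ++ [b]) : ℝ) / E (c ++ [b]) := by
      rw [NNRat.cast_def]
    have e2 : ∀ b, (E (c ++ [b]) : ℝ) ≠ 0 := fun b => by
      have := hEpos (c ++ [b]); positivity
    simp only [a, γ]
    rw [e1, List.length_append, List.length_singleton]
    have := e2 false
    have := e2 true
    cases b <;> push_cast <;> field_simp <;> simp
  have hM : ∀ s, |P.real (cylinder s) + 1 / 2 ^ s.length - a s| < 1 / 4 ^ (s.length + 1) := by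
    intro s
    have := hA s (4 ^ (s.length + 1)) (Nat.one_le_pow _ _ (by norm_num))
    push_cast at this
    rwa [show P.real (cylinder s) + 1 / 2 ^ s.length - a s =
      P.real (cylinder s) - (A s (4 ^ (s.length + 1)) : ℝ) by simp only [a]; ring]
  -- `a` is only approximately additive. With `w = 2 ^ (-k)` the excess is at most `w * w`, and `w *
  -- w * (k + 1) ≤ w ≤ a c`, so the relative loss is at most `(k + 2) / (k + 1)`.
  have hstep : ∀ c : List Bool, (a (c ++ [false]) + a (c ++ [true])) * (c.length + 1) ≤
      a c * (c.length + 2) := by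
    intro c
    have h0 := (abs_lt.1 (hM (c ++ [false]))).1
    have h1 := (abs_lt.1 (hM (c ++ [true]))).1
    have h2 := (abs_lt.1 (hM c)).2
    have h3 := measureReal_cylinder_add P c
    have h4 := hapos c
    rw [List.length_append, List.length_singleton] at h0 h1
    have h5 : ((c.length : ℝ) + 1) ≤ 2 ^ c.length := by
      exact_mod_cast Nat.lt_two_pow_self (n := c.length)
    set k := c.length
    have e2 : (1 : ℝ) / 2 ^ (k + 1) = 1 / 2 ^ k / 2 := by rw [pow_succ]; field_simp
    have e4 : (1 : ℝ) / 4 ^ (k + 1) = (1 / 2 ^ k) * (1 / 2 ^ k) / 4 := by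
      rw [pow_succ, show (4 : ℝ) = 2 * 2 by norm_num, mul_pow]; field_simp
    have e4' : (1 : ℝ) / 4 ^ (k + 1 + 1) = (1 / 2 ^ k) * (1 / 2 ^ k) / 16 := by
      rw [pow_succ, pow_succ, show (4 : ℝ) = 2 * 2 by norm_num, mul_pow]; field_simp; norm_num
    rw [e2, e4'] at h0 h1
    rw [e4] at h2
    set w : ℝ := 1 / 2 ^ k with hw
    have hwpos : 0 < w := by positivity
    have h6 : w * ((k : ℝ) + 1) ≤ 1 := by
      rw [hw, one_div, inv_mul_le_iff₀ (by positivity)]; linarith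
    have h7 : a (c ++ [false]) + a (c ++ [true]) ≤ a c + w * w := by nlinarith
    have hk1 : (0 : ℝ) ≤ (k : ℝ) + 1 := by positivity
    calc (a (c ++ [false]) + a (c ++ [true])) * ((k : ℝ) + 1)
        ≤ (a c + w * w) * ((k : ℝ) + 1) := by gcongr
      _ = a c * ((k : ℝ) + 1) + w * (w * ((k : ℝ) + 1)) := by ring
      _ ≤ a c * ((k : ℝ) + 1) + w * 1 := by gcongr
      _ ≤ a c * ((k : ℝ) + 2) := by nlinarith
  refine ⟨γ, hγ, hpos, fun y n => ?_⟩
  -- The losses `(k + 2) / (k + 1)` telescope to the factor `n + 1`.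
  have key : ∀ n, a (initSeg y n) *
      ∏ i ∈ Finset.range n, ((γ (initSeg y i) false : ℝ) + γ (initSeg y i) true) ≤
      a [] * (n + 1) * ∏ i ∈ Finset.range n, (γ (initSeg y i) (y i) : ℝ) := by
    intro n
    induction n with
    | zero => simp [initSeg]
    | succ n ih =>
      rw [Finset.prod_range_succ, Finset.prod_range_succ, initSeg_succ]
      set T := ∏ i ∈ Finset.range n, ((γ (initSeg y i) false : ℝ) + γ (initSeg y i) true)
      set G := ∏ i ∈ Finset.range n, (γ (initSeg y i) (y i) : ℝ)
      have hT : 0 ≤ T := Finset.prod_nonneg fun _ _ => by positivity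
      set c := initSeg y n with hc
      have hs := hstep c
      rw [show c.length = n from length_initSeg y n] at hs
      rw [hscale c false, hscale c true, hscale c (y n)]
      set σ : ℝ := 2 ^ (c.length + 1) * E (c ++ [false]) * E (c ++ [true])
      have hσ : 0 ≤ σ := by positivity
      have hab : 0 ≤ a (c ++ [y n]) := le_trans (by positivity) (hapos _)
      have hn : (0 : ℝ) < (n : ℝ) + 1 := by positivity
      rw [← mul_le_mul_iff_left₀ hn]
      push_cast
      calc a (c ++ [y n]) * (T * (a (c ++ [false]) * σ + a (c ++ [true]) * σ)) * ((n : ℝ) + 1)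
          = a (c ++ [y n]) * σ * T * ((a (c ++ [false]) + a (c ++ [true])) * ((n : ℝ) + 1)) := by
            ring
        _ ≤ a (c ++ [y n]) * σ * T * (a c * ((n : ℝ) + 2)) := by gcongr
        _ = a (c ++ [y n]) * σ * ((n : ℝ) + 2) * (a c * T) := by ring
        _ ≤ a (c ++ [y n]) * σ * ((n : ℝ) + 2) * (a [] * ((n : ℝ) + 1) * G) := by gcongr
        _ = _ := by ring
  have hT : 0 ≤ ∏ i ∈ Finset.range n, ((γ (initSeg y i) false : ℝ) + γ (initSeg y i) true) :=
    Finset.prod_nonneg fun _ _ => by positivity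
  have ha0 : a [] ≤ 3 := by
    have h1 := (abs_lt.1 (hM [])).1
    have h2 : P.real (cylinder []) ≤ 1 := measureReal_le_one
    norm_num at h1
    linarith
  have han : P.real (cylinder (initSeg y n)) ≤ a (initSeg y n) := by
    have h1 := (abs_lt.1 (hM (initSeg y n))).2
    rw [length_initSeg] at h1
    have h2 : (1 : ℝ) / 4 ^ (n + 1) ≤ 1 / 2 ^ n := by
      refine one_div_le_one_div_of_le (by positivity) ?_
      calc (2 : ℝ) ^ n ≤ 4 ^ n := by gcongr; norm_num
        _ ≤ 4 ^ (n + 1) := by gcongr <;> norm_num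
    linarith
  calc _ ≤ a (initSeg y n) * _ := mul_le_mul_of_nonneg_right han hT
    _ ≤ _ := key n
    _ ≤ _ := by gcongr

end ComputableMeasure

end AlgComplexity

namespace AlgComplexity

/-! ### Code lengths, and why the ones of `y` are not all predictable -/

section CodeLength

variable {U : List Bool → List Bool →. List Bool}

/-- The ideal code length of the bit `b` after the context `c` under the weights `γ`. -/
noncomputable def cost (γ : List Bool → Bool → ℕ) (c : List Bool) (b : Bool) : ℝ :=
  Real.logb 2 (((γ c false : ℝ) + γ c true) / γ c b)

/-- The ideal code length of the first `n` bits of `y` under the weights `γ`. -/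
noncomputable def codeLen (γ : List Bool → Bool → ℕ) (y : ℕ → Bool) (n : ℕ) : ℝ :=
  ∑ i ∈ Finset.range n, cost γ (initSeg y i) (y i)

/-- The conditional probability of the bit opposite to `b` after `c`. -/
noncomputable def errProb (γ : List Bool → Bool → ℕ) (c : List Bool) (b : Bool) : ℝ :=
  (γ c (!b) : ℝ) / ((γ c false : ℝ) + γ c true)

theorem codeLen_eq {γ : List Bool → Bool → ℕ} (hpos : ∀ c b, 0 < γ c b) (y : ℕ → Bool) (n : ℕ) :
    codeLen γ y n = Real.logb 2
      ((∏ i ∈ Finset.range n, ((γ (initSeg y i) false : ℝ) + γ (initSeg y i) true)) /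
        ∏ i ∈ Finset.range n, (γ (initSeg y i) (y i) : ℝ)) := by
  rw [← Finset.prod_div_distrib, Real.logb_prod]
  · rfl
  · intro i _
    have h1 := hpos (initSeg y i) false
    have h2 := hpos (initSeg y i) (y i)
    positivity

theorem prod_le_two_pow_ceil_codeLen {γ : List Bool → Bool → ℕ} (hpos : ∀ c b, 0 < γ c b)
    (y : ℕ → Bool) (n : ℕ) :
    ∏ i ∈ Finset.range n, (γ (initSeg y i) false + γ (initSeg y i) true) ≤
      2 ^ ⌈codeLen γ y n⌉₊ * ∏ i ∈ Finset.range n, γ (initSeg y i) (y i) := by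
  have h1 : 0 < ∏ i ∈ Finset.range n, ((γ (initSeg y i) false : ℝ) + γ (initSeg y i) true) :=
    Finset.prod_pos fun i _ => by have := hpos (initSeg y i) false; positivity
  have h2 : 0 < ∏ i ∈ Finset.range n, (γ (initSeg y i) (y i) : ℝ) :=
    Finset.prod_pos fun i _ => by have := hpos (initSeg y i) (y i); positivity
  have h3 := Nat.le_ceil (codeLen γ y n)
  nth_rewrite 1 [codeLen_eq hpos] at h3
  rw [Real.logb_le_iff_le_rpow (by norm_num) (by positivity), Real.rpow_natCast,
    div_le_iff₀ h2] at h3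
  exact_mod_cast h3

/-- The linear bound `B * n` is only there to make the error term logarithmic. The maximum with `0`
comes from rounding up to a natural number. -/
theorem eventually_prefixK_le_codeLen (hU : IsOptimalPrefixMachine U) {γ : List Bool → Bool → ℕ}
    (hγ : Computable fun z : List Bool × Bool => γ z.1 z.2) (hpos : ∀ c b, 0 < γ c b)
    (y : ℕ → Bool) (B : ℝ) {ε : ℝ} (hε : 0 < ε) :
    ∀ᶠ n : ℕ in atTop, codeLen γ y n ≤ B * n →
      (prefixK U (initSeg y n) : ℝ) ≤ max (codeLen γ y n) 0 + ε * n := by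
  obtain ⟨c, hc⟩ := prefixK_le_of_weights hU hγ hpos
  set C := ⌈max B 0⌉₊ + 1 with hC
  filter_upwards [eventually_slack_le C (c + 1) hε] with n hn hB
  have h1 : (⌈codeLen γ y n⌉₊ : ℝ) ≤ max (codeLen γ y n) 0 + 1 := by
    rcases le_total (codeLen γ y n) 0 with h | h
    · rw [Nat.ceil_eq_zero.2 h, max_eq_right h]; norm_num
    · rw [max_eq_left h]; exact (Nat.ceil_lt_add_one h).le
  have h2 : ⌈codeLen γ y n⌉₊ ≤ C * n + C := by
    refine Nat.ceil_le.2 (hB.trans ?_)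
    have h3 : B ≤ ⌈max B 0⌉₊ := (le_max_left _ _).trans (Nat.le_ceil _)
    rw [hC]
    push_cast
    have h4 : (0 : ℝ) ≤ ⌈max B 0⌉₊ := Nat.cast_nonneg _
    have h5 : (0 : ℝ) ≤ n := Nat.cast_nonneg _
    nlinarith
  have h3 := hc y n _ (C * n + C) (by nlinarith) h2 (prod_le_two_pow_ceil_codeLen hpos y n)
  have h4 : (prefixK U (initSeg y n) : ℝ) ≤
      ⌈codeLen γ y n⌉₊ + 6 * (Nat.size (C * n + C) : ℝ) + c := by exact_mod_cast h3
  push_cast at hn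
  linarith

theorem log_two_bounds : (1 : ℝ) / 2 ≤ Real.log 2 ∧ Real.log 2 ≤ 1 :=
  ⟨by linarith [Real.log_two_gt_d9], by linarith [Real.log_two_lt_d9]⟩

theorem logb_le_of_log_le {z t : ℝ} (h : Real.log z ≤ t) (ht : 0 ≤ t) :
    Real.logb 2 z ≤ 2 * t := by
  have h2 := log_two_bounds.1
  rw [Real.logb, div_le_iff₀ (by linarith)]
  nlinarith

theorem le_logb_of_le_log {z t : ℝ} (h : t ≤ Real.log z) (ht : 0 ≤ t) : t ≤ Real.logb 2 z := by
  have h1 := log_two_bounds.1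
  have h2 := log_two_bounds.2
  rw [Real.logb, le_div_iff₀ (by linarith)]
  nlinarith

/-- The weights `γ` with the probability `p` of a one replaced by `p (1 + p) / 2`. -/
def shrink (γ : List Bool → Bool → ℕ) (c : List Bool) (b : Bool) : ℕ :=
  bif b then γ c true * (2 * γ c true + γ c false) else γ c false * (3 * γ c true + 2 * γ c false)

/-- A mixture of the weights `γ` and the uniform weights. -/
def smooth (J : ℕ) (γ : List Bool → Bool → ℕ) (c : List Bool) (b : Bool) : ℕ :=
  2 * J * γ c b + (γ c false + γ c true)

theorem computable_shrink {γ : List Bool → Bool → ℕ}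
    (hγ : Computable fun z : List Bool × Bool => γ z.1 z.2) :
    Computable fun z : List Bool × Bool => shrink γ z.1 z.2 := by
  have h : ∀ b, Computable fun z : List Bool × Bool => γ z.1 b := fun b =>
    hγ.comp (Computable.fst.pair (Computable.const b))
  exact Computable.cond Computable.snd
    (computable_mul (h true) (computable_add (computable_mul (Computable.const 2) (h true))
      (h false)))
    (computable_mul (h false) (computable_add (computable_mul (Computable.const 3) (h true))
      (computable_mul (Computable.const 2) (h false))))

theorem computable_smooth (J : ℕ) {γ : List Bool → Bool → ℕ}
    (hγ : Computable fun z : List Bool × Bool => γ z.1 z.2) :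
    Computable fun z : List Bool × Bool => smooth J γ z.1 z.2 := by
  have h : ∀ b, Computable fun z : List Bool × Bool => γ z.1 b := fun b =>
    hγ.comp (Computable.fst.pair (Computable.const b))
  exact computable_add (computable_mul (Computable.const (2 * J)) hγ)
    (computable_add (h false) (h true))

theorem shrink_pos {γ : List Bool → Bool → ℕ} (hpos : ∀ c b, 0 < γ c b) (c : List Bool) (b : Bool) :
    0 < shrink γ c b := by
  have h1 := hpos c true
  have h2 := hpos c false
  cases b <;> simp only [shrink, cond_true, cond_false] <;> positivity

theorem smooth_pos (J : ℕ) {γ : List Bool → Bool → ℕ} (hpos : ∀ c b, 0 < γ c b) (c : List Bool)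
    (b : Bool) : 0 < smooth J γ c b := Nat.add_pos_right _ (Nat.add_pos_left (hpos c false) _)

theorem errProb_nonneg (γ : List Bool → Bool → ℕ) (c : List Bool) (b : Bool) :
    0 ≤ errProb γ c b := by unfold errProb; positivity

/-- The probability `p` of a one is multiplied by `(1 + p) / 2 = 1 - (1 - p) / 2`, so a well
predicted one loses almost nothing. -/
theorem cost_shrink_true {γ : List Bool → Bool → ℕ} (hpos : ∀ c b, 0 < γ c b) (c : List Bool) :
    cost (shrink γ) c true ≤ cost γ c true + 2 * errProb γ c true := by
  have h1 : (0 : ℝ) < γ c true := by exact_mod_cast hpos c true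
  have h2 : (0 : ℝ) < γ c false := by exact_mod_cast hpos c false
  set α : ℝ := (γ c true : ℝ)
  set β : ℝ := (γ c false : ℝ)
  have e : ((shrink γ c false : ℕ) + (shrink γ c true : ℕ) : ℝ) / (shrink γ c true : ℕ) =
      (β + α) / α * (2 * (α + β) / (2 * α + β)) := by
    simp only [shrink, cond_true, cond_false]
    push_cast
    change (β * (3 * α + 2 * β) + α * (2 * α + β)) / (α * (2 * α + β)) = _
    field_simp
    ring
  rw [cost, e, Real.logb_mul (by positivity) (by positivity), cost]
  refine add_le_add le_rfl (logb_le_of_log_le ?_ (errProb_nonneg _ _ _))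
  refine (Real.log_le_sub_one_of_pos (by positivity)).trans ?_
  simp only [errProb, Bool.not_true]
  change 2 * (α + β) / (2 * α + β) - 1 ≤ β / (β + α)
  rw [div_sub_one (by positivity), div_le_div_iff₀ (by positivity) (by positivity)]
  nlinarith [mul_pos h1 h2]

/-- The probability of a zero is multiplied by `1 + p / 2`. The gain is at least `(p / 2) / (1 + p /
2) ≥ p / 3`, proportional to the error made at the zero. -/
theorem cost_shrink_false {γ : List Bool → Bool → ℕ} (hpos : ∀ c b, 0 < γ c b) (c : List Bool) :
    cost (shrink γ) c false ≤ cost γ c false - errProb γ c false / 3 := by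
  have h1 : (0 : ℝ) < γ c true := by exact_mod_cast hpos c true
  have h2 : (0 : ℝ) < γ c false := by exact_mod_cast hpos c false
  set α : ℝ := (γ c true : ℝ)
  set β : ℝ := (γ c false : ℝ)
  have e : ((shrink γ c false : ℕ) + (shrink γ c true : ℕ) : ℝ) / (shrink γ c false : ℕ) =
      (β + α) / β / ((3 * α + 2 * β) / (2 * (α + β))) := by
    simp only [shrink, cond_true, cond_false]
    push_cast
    change (β * (3 * α + 2 * β) + α * (2 * α + β)) / (β * (3 * α + 2 * β)) = _
    field_simp
    ring
  rw [cost, e, Real.logb_div (by positivity) (by positivity), cost]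
  have he : (0 : ℝ) ≤ errProb γ c false / 3 := div_nonneg (errProb_nonneg _ _ _) (by norm_num)
  refine sub_le_sub le_rfl (le_logb_of_le_log ?_ he)
  refine le_trans ?_ (Real.one_sub_inv_le_log_of_pos (by positivity))
  simp only [errProb, Bool.not_false]
  change α / (β + α) / 3 ≤ 1 - ((3 * α + 2 * β) / (2 * (α + β)))⁻¹
  rw [inv_div, one_sub_div (by positivity), div_div, div_le_div_iff₀ (by positivity) (by positivity)]
  nlinarith [mul_pos h1 h2, mul_pos h1 h1]

/-- The uniform share `1 / (J + 1)` bounds the cost of even a badly mispredicted bit, so the total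
cost becomes linear in the errors; a well predicted bit costs only `O(1 / J)`. -/
theorem cost_smooth_le (J : ℕ) {γ : List Bool → Bool → ℕ} (hpos : ∀ c b, 0 < γ c b) (c : List Bool)
    (b : Bool) : cost (smooth J γ) c b ≤ 2 / (J + 1) + 12 * (J + 1) * errProb γ c b := by
  have hT : (0 : ℝ) < (γ c false : ℝ) + γ c true := by
    have := hpos c false; positivity
  have he0 := errProb_nonneg γ c b
  have hb : (γ c b : ℝ) = (1 - errProb γ c b) * ((γ c false : ℝ) + γ c true) := by
    rw [errProb]; cases b <;> field_simp <;> simp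
  have he1 : errProb γ c b < 1 := by
    have : (0 : ℝ) < γ c b := by exact_mod_cast hpos c b
    rw [hb] at this
    have := (pos_iff_pos_of_mul_pos this).2 hT
    linarith
  set e := errProb γ c b
  set T := (γ c false : ℝ) + γ c true
  have hJ : (0 : ℝ) < (J : ℝ) + 1 := by positivity
  have hz : ((smooth J γ c false : ℕ) + (smooth J γ c true : ℕ) : ℝ) / (smooth J γ c b : ℕ) =
      2 * (J + 1) / (2 * J * (1 - e) + 1) := by
    simp only [smooth]
    push_cast
    rw [hb]
    have h1 : 0 < 2 * (J : ℝ) * (1 - e) + 1 := by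
      have : 0 ≤ (J : ℝ) * (1 - e) := mul_nonneg (Nat.cast_nonneg _) (by linarith)
      linarith
    rw [div_eq_div_iff (by change 2 * (J : ℝ) * ((1 - e) * T) + T ≠ 0; nlinarith [mul_pos h1 hT]) h1.ne']
    change (2 * (J : ℝ) * γ c false + T + (2 * J * γ c true + T)) * _ =
      _ * (2 * (J : ℝ) * ((1 - e) * T) + T)
    have : (2 * (J : ℝ) * γ c false + T + (2 * J * γ c true + T)) = 2 * (J + 1) * T := by
      simp only [T]; ring
    rw [this]; ring
  rw [cost, hz]
  have hJe : 0 ≤ (J : ℝ) * (1 - e) := mul_nonneg (Nat.cast_nonneg _) (by linarith)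
  have hd : 0 < 2 * (J : ℝ) * (1 - e) + 1 := by linarith
  have key : Real.log (2 * (J + 1) / (2 * J * (1 - e) + 1)) ≤ 1 / (J + 1) + 6 * (J + 1) * e := by
    refine (Real.log_le_sub_one_of_pos (by positivity)).trans ?_
    rw [div_sub_one hd.ne', div_le_iff₀ hd]
    have h3 : 1 / ((J : ℝ) + 1) * (J + 1) = 1 := by field_simp
    have h4 : (0 : ℝ) < 1 / ((J : ℝ) + 1) := by positivity
    have hJ0 : (0 : ℝ) ≤ J := Nat.cast_nonneg _
    -- For `e ≤ 1 / 2` the denominator is at least `J + 1`. For larger `e` the trivial bound by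
    -- about `2 * (J + 1)` is absorbed by the term in `e`.
    rcases le_total e (1 / 2) with h | h
    · have h5 : (J : ℝ) + 1 ≤ 2 * J * (1 - e) + 1 := by nlinarith
      have h6 : 1 ≤ 1 / ((J : ℝ) + 1) * (2 * J * (1 - e) + 1) := by
        calc (1 : ℝ) = 1 / ((J : ℝ) + 1) * (J + 1) := h3.symm
          _ ≤ _ := by gcongr
      have h7 : 6 * ((J : ℝ) + 1) * e * 1 ≤ 6 * ((J : ℝ) + 1) * e * (2 * J * (1 - e) + 1) := by
        gcongr; linarith
      nlinarith [mul_nonneg hJ0 he0]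
    · have h6 : 0 ≤ 1 / ((J : ℝ) + 1) * (2 * J * (1 - e) + 1) := by positivity
      have h7 : 6 * ((J : ℝ) + 1) * (1 / 2) * 1 ≤ 6 * ((J : ℝ) + 1) * e * (2 * J * (1 - e) + 1) := by
        gcongr; linarith
      nlinarith
  refine (logb_le_of_log_le key (by positivity)).trans_eq ?_
  ring

/-- If `y` has positive complexity rate and the code length of `y` under `γ` is asymptotically
optimal, then the ones in `y` are not almost all predicted with probability close to one. -/
theorem exists_frequently_le_sum_sq (hU : IsOptimalPrefixMachine U) {γ : List Bool → Bool → ℕ}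
    (hγ : Computable fun z : List Bool × Bool => γ z.1 z.2) (hpos : ∀ c b, 0 < γ c b)
    {y : ℕ → Bool} {h : ℝ} (hh : 0 < h)
    (hK : Tendsto (fun n : ℕ => (prefixK U (initSeg y n) : ℝ) / n) atTop (𝓝 h))
    (hL : ∀ ε > 0, ∀ᶠ n : ℕ in atTop, codeLen γ y n ≤ (h + ε) * n) :
    ∃ ε > 0, ∃ᶠ n : ℕ in atTop, ε * n ≤
      ∑ i ∈ Finset.range n, if y i then errProb γ (initSeg y i) true ^ 2 else 0 := by
  by_contra! hcon
  obtain ⟨J, hJ⟩ := exists_nat_gt (16 / h)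
  have hJ0 : (0 : ℝ) < (J : ℝ) + 1 := by positivity
  have hJh : 2 / ((J : ℝ) + 1) ≤ h / 8 := by
    rw [div_le_div_iff₀ hJ0 (by norm_num)]
    rw [div_lt_iff₀ hh] at hJ
    nlinarith
  -- All errors together will amount to at most `23 * η * n`, which `smooth` turns into at most `12
  -- * (J + 1) * 23 * η * n ≤ h / 8 * n` bits.
  set η : ℝ := h / (2400 * ((J : ℝ) + 1)) with hη
  have hη0 : 0 < η := by positivity
  have hηh : η ≤ h / 8 := by
    rw [hη]
    refine div_le_div_of_nonneg_left hh.le (by norm_num) ?_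
    have : (0 : ℝ) ≤ J := Nat.cast_nonneg _
    linarith
  have hη12 : 12 * ((J : ℝ) + 1) * (23 * η) ≤ h / 8 := by
    rw [hη]; field_simp; norm_num
  have hV := hcon (η ^ 2) (by positivity)
  have hmul : (0 : ℝ) ≤ 12 * ((J : ℝ) + 1) := by positivity
  set B1 : ℝ := h + η + 4 * η
  obtain ⟨n, hn0, hV, hL, hK1, hc1, hc2⟩ := ((eventually_gt_atTop 0).and
    (hV.and ((hL η hη0).and ((hK.eventually_const_lt
      (show h - η < h by linarith)).and ((eventually_prefixK_le_codeLen hU (computable_shrink hγ)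
        (shrink_pos hpos) y B1 hη0).and (eventually_prefixK_le_codeLen hU (computable_smooth J hγ)
        (smooth_pos J hpos) y h hη0)))))).exists
  have hn : (0 : ℝ) < n := by exact_mod_cast hn0
  rw [lt_div_iff₀ hn] at hK1
  set S1 := ∑ i ∈ Finset.range n, if y i then errProb γ (initSeg y i) true else 0 with hS1
  set S0 := ∑ i ∈ Finset.range n, if y i then 0 else errProb γ (initSeg y i) false with hS0
  have hS0nn : 0 ≤ S0 := Finset.sum_nonneg fun i _ => by
    split_ifs <;> simp [errProb_nonneg]
  -- From small squares to small errors by `u ≤ η + u² / η`.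
  have hS1le : S1 ≤ 2 * η * n := by
    have h1 : S1 ≤ ∑ i ∈ Finset.range n,
        (η + (if y i then errProb γ (initSeg y i) true ^ 2 else 0) / η) := by
      refine Finset.sum_le_sum fun i _ => ?_
      split_ifs
      · rw [← sub_nonneg]
        set u := errProb γ (initSeg y i) true
        have : η + u ^ 2 / η - u = ((u - η / 2) ^ 2 + 3 / 4 * η ^ 2) / η := by
          field_simp; ring
        rw [this]; positivity
      · simp [hη0.le]
    rw [Finset.sum_add_distrib, Finset.sum_const, Finset.card_range, nsmul_eq_mul,
      ← Finset.sum_div] at h1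
    have h2 : (∑ i ∈ Finset.range n, if y i then errProb γ (initSeg y i) true ^ 2 else 0) / η ≤
        η * n := by
      rw [div_le_iff₀ hη0]; nlinarith
    linarith
  have hshrink : codeLen (shrink γ) y n ≤ codeLen γ y n + 2 * S1 - S0 / 3 := by
    have : codeLen γ y n + 2 * S1 - S0 / 3 = ∑ i ∈ Finset.range n, (cost γ (initSeg y i) (y i) +
        2 * (if y i then errProb γ (initSeg y i) true else 0) -
        (if y i then 0 else errProb γ (initSeg y i) false) / 3) := by
      rw [Finset.sum_sub_distrib, Finset.sum_add_distrib, ← Finset.mul_sum, ← Finset.sum_div]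
      rfl
    rw [this]
    refine Finset.sum_le_sum fun i _ => ?_
    cases hy : y i
    · simpa using cost_shrink_false hpos (initSeg y i)
    · simpa using cost_shrink_true hpos (initSeg y i)
  have hsmooth : codeLen (smooth J γ) y n ≤
      2 / (J + 1) * n + 12 * (J + 1) * (S1 + S0) := by
    have : 2 / ((J : ℝ) + 1) * n + 12 * (J + 1) * (S1 + S0) = ∑ i ∈ Finset.range n,
        (2 / ((J : ℝ) + 1) + 12 * (J + 1) * errProb γ (initSeg y i) (y i)) := by
      rw [Finset.sum_add_distrib, ← Finset.mul_sum, Finset.sum_const, Finset.card_range,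
        nsmul_eq_mul, mul_comm (n : ℝ), hS1, hS0, ← Finset.sum_add_distrib]
      congr 2
      refine Finset.sum_congr rfl fun i _ => ?_
      cases y i <;> simp
    rw [this]
    exact Finset.sum_le_sum fun i _ => cost_smooth_le J hpos _ _
  have hc1 := hc1 (by simp only [B1]; nlinarith)
  -- `shrink` cannot beat the complexity, so `S0 / 3` is at most the sum of `η * n` for the lower
  -- bound on `K`, `η * n` for the code length, `η * n` for the coding error and `4 * η * n` for the
  -- loss `2 * S1`.
  have hS0le : S0 ≤ 21 * η * n := by
    have : max (codeLen (shrink γ) y n) 0 ≤ max (codeLen γ y n + 2 * S1 - S0 / 3) 0 :=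
      max_le_max hshrink le_rfl
    rcases max_cases (codeLen γ y n + 2 * S1 - S0 / 3) 0 with ⟨h1, -⟩ | ⟨h1, -⟩ <;>
      rw [h1] at this <;> nlinarith
  -- With both kinds of errors small, the smoothed code has rate at most `h / 4`, which is
  -- incompatible with a complexity above `(h - η) * n`.
  have hlow : codeLen (smooth J γ) y n ≤ h / 4 * n := by
    have h1 : 2 / ((J : ℝ) + 1) * n ≤ h / 8 * n := by gcongr
    have h2 : 12 * ((J : ℝ) + 1) * (S1 + S0) ≤ 12 * ((J : ℝ) + 1) * (23 * η * n) :=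
      mul_le_mul_of_nonneg_left (by linarith) hmul
    have h3 : 12 * ((J : ℝ) + 1) * (23 * η) * n ≤ h / 8 * n := by gcongr
    linarith
  have hc2 := hc2 (by nlinarith)
  have : max (codeLen (smooth J γ) y n) 0 ≤ h / 4 * n := max_le hlow (by positivity)
  nlinarith [mul_pos hh hn]

end CodeLength

end AlgComplexity

namespace AlgComplexity

/-! ### A random sequence coupled to `y` -/

section RandomSelection

variable {U : List Bool → List Bool →. List Bool}

open Classical in
/-- Borel–Cantelli for sequences of independent bits with given distributions: events that depend on
initial segments and have summable probabilities can be avoided simultaneously. -/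
theorem exists_avoiding {ι : Type*} [Countable ι] {θ : ℕ → Bool → ℝ} (h0 : ∀ i b, 0 ≤ θ i b)
    (h1 : ∀ i, θ i false + θ i true = 1) (A : ι → ℕ → Set (List Bool)) {b : ι → ℕ → ℝ}
    (hb : ∀ j, Summable (b j))
    (h : ∀ j, ∀ᶠ n : ℕ in atTop, ∑ s ∈ (strs n).toFinset with s ∈ A j n,
      ∏ i ∈ Finset.range n, θ i (s.getD i false) ≤ b j n) :
    ∃ x : ℕ → Bool, ∀ j, ∀ᶠ n : ℕ in atTop, initSeg x n ∉ A j n := by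
  let μ : ℕ → Measure Bool := fun i => ENNReal.ofReal (θ i false) • Measure.dirac false +
    ENNReal.ofReal (θ i true) • Measure.dirac true
  have hμ : ∀ i, IsProbabilityMeasure (μ i) := fun i => ⟨by
    simp only [μ, Measure.add_apply, Measure.smul_apply, measure_univ, smul_eq_mul, mul_one]
    rw [← ENNReal.ofReal_add (h0 _ _) (h0 _ _), h1, ENNReal.ofReal_one]⟩
  have hμs : ∀ i c, μ i {c} = ENNReal.ofReal (θ i c) := by
    intro i c
    cases c <;> simp [μ]
  let W : Measure (ℕ → Bool) := Measure.infinitePi μ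
  have hcyl : ∀ (n : ℕ) (s : List Bool), W {x | initSeg x n = s} ≤
      ENNReal.ofReal (∏ i ∈ Finset.range n, θ i (s.getD i false)) := by
    intro n s
    rw [ENNReal.ofReal_prod_of_nonneg fun i _ => h0 _ _]
    simp_rw [← hμs]
    rw [← Measure.infinitePi_pi (μ := μ) (s := Finset.range n) (t := fun i => {s.getD i false})
      fun i _ => measurableSet_singleton _]
    refine measure_mono fun x hx i hi => ?_
    have hx : initSeg x n = s := hx
    rw [← hx]
    exact (getD_initSeg x (by simpa using hi)).symm
  have hev : ∀ (n : ℕ) (B : Set (List Bool)), W {x | initSeg x n ∈ B} ≤ ENNReal.ofReal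
      (∑ s ∈ (strs n).toFinset with s ∈ B, ∏ i ∈ Finset.range n, θ i (s.getD i false)) := by
    intro n B
    rw [ENNReal.ofReal_sum_of_nonneg fun s _ => Finset.prod_nonneg fun i _ => h0 _ _]
    calc W {x | initSeg x n ∈ B}
        ≤ W (⋃ s ∈ (strs n).toFinset.filter (· ∈ B), {x | initSeg x n = s}) := by
          refine measure_mono fun x hx => ?_
          simp only [Set.mem_iUnion]
          exact ⟨initSeg x n, Finset.mem_filter.2
            ⟨List.mem_toFinset.2 (mem_strs.2 (length_initSeg x n)), hx⟩, rfl⟩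
      _ ≤ _ := (measure_biUnion_finset_le _ _).trans (Finset.sum_le_sum fun s _ => hcyl n s)
  have hae : ∀ j, ∀ᵐ x ∂W, ∀ᶠ n : ℕ in atTop, initSeg x n ∉ A j n := by
    intro j
    obtain ⟨N, hN⟩ := eventually_atTop.1 (h j)
    -- The bound holds only from `N` on, so the earlier events are replaced by the empty set before
    -- Borel–Cantelli is applied.
    have hsum : ∑' n, W (if N ≤ n then {x | initSeg x n ∈ A j n} else ∅) ≠ ⊤ := by
      refine ne_top_of_le_ne_top (hb j).tsum_ofReal_ne_top (ENNReal.tsum_le_tsum fun n => ?_)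
      split_ifs with hn
      · exact (hev n _).trans (ENNReal.ofReal_le_ofReal (hN n hn))
      · simp
    filter_upwards [ae_eventually_notMem hsum] with x hx
    filter_upwards [hx, eventually_ge_atTop N] with n hn hNn
    rw [if_pos hNn] at hn
    exact hn
  exact (ae_all_iff.2 hae).exists

/-- The transition from `y` to `x` for which `x` is uniform if `y` is distributed according to `γ`,
while `x` agrees with `y` as much as this allows. -/
def coupling (γ : List Bool → Bool → ℕ) (c : List Bool) (b b' : Bool) : ℕ :=
  bif b then (bif b' then γ c true + 2 * γ c false else γ c true)
  else (bif b' then γ c false else 2 * γ c true + γ c false)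

/-- The total weight of `coupling`. -/
def couplingTotal (γ : List Bool → Bool → ℕ) (c : List Bool) : ℕ := 2 * (γ c false + γ c true)

/-- The weights used to code a bit of `x` at a position where `y` has a one: they have half the bias
of `coupling`. -/
def tilt (γ : List Bool → Bool → ℕ) (c : List Bool) (b : Bool) : ℕ :=
  bif b then 2 * γ c true + 3 * γ c false else 2 * γ c true + γ c false

variable {γ : List Bool → Bool → ℕ}

theorem computable_coupling (hγ : Computable fun z : List Bool × Bool => γ z.1 z.2) :
    Computable fun z : List Bool × Bool × Bool => coupling γ z.1 z.2.1 z.2.2 := by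
  have h : ∀ b, Computable fun z : List Bool × Bool × Bool => γ z.1 b := fun b =>
    hγ.comp (Computable.fst.pair (Computable.const b))
  have h2 : ∀ b, Computable fun z : List Bool × Bool × Bool => 2 * γ z.1 b := fun b =>
    computable_mul (Computable.const 2) (h b)
  have hb' : Computable fun z : List Bool × Bool × Bool => z.2.2 :=
    Computable.snd.comp Computable.snd
  exact Computable.cond (Computable.fst.comp Computable.snd)
    (Computable.cond hb' (computable_add (h true) (h2 false)) (h true))
    (Computable.cond hb' (h false) (computable_add (h2 true) (h false)))

theorem computable_couplingTotal (hγ : Computable fun z : List Bool × Bool => γ z.1 z.2) :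
    Computable (couplingTotal γ) := by
  have h : ∀ b, Computable fun c : List Bool => γ c b := fun b =>
    hγ.comp (Computable.id.pair (Computable.const b))
  exact computable_mul (Computable.const 2) (computable_add (h false) (h true))

theorem computable_tilt (hγ : Computable fun z : List Bool × Bool => γ z.1 z.2) :
    Computable fun z : List Bool × Bool => tilt γ z.1 z.2 := by
  have h : ∀ b, Computable fun z : List Bool × Bool => γ z.1 b := fun b =>
    hγ.comp (Computable.fst.pair (Computable.const b))
  have h2 := computable_mul (Computable.const 2) (h true)
  exact Computable.cond Computable.snd
    (computable_add h2 (computable_mul (Computable.const 3) (h false))) (computable_add h2 (h false))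

theorem tilt_pos (hpos : ∀ c b, 0 < γ c b) (c : List Bool) (b : Bool) : 0 < tilt γ c b := by
  have h1 := hpos c true
  cases b <;> simp only [tilt, cond_true, cond_false] <;> omega

theorem tilt_add (c : List Bool) : tilt γ c false + tilt γ c true = 2 * couplingTotal γ c := by
  simp only [tilt, couplingTotal, cond_true, cond_false]; ring

theorem couplingTotal_pos (hpos : ∀ c b, 0 < γ c b) (c : List Bool) : 0 < couplingTotal γ c := by
  have h1 := hpos c true
  unfold couplingTotal; omega

theorem coupling_uniform (c : List Bool) (b : Bool) :
    2 * (γ c false * coupling γ c false b + γ c true * coupling γ c true b) =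
      (γ c false + γ c true) * couplingTotal γ c := by
  cases b <;> simp only [coupling, couplingTotal, cond_true, cond_false] <;> ring

theorem coupling_add (c : List Bool) (b : Bool) :
    coupling γ c b false + coupling γ c b true = couplingTotal γ c := by
  cases b <;> simp only [coupling, couplingTotal, cond_true, cond_false] <;> ring

/-- The conditional distribution of the `i`-th bit of `x` given `y`. -/
noncomputable def bitLaw (γ : List Bool → Bool → ℕ) (y : ℕ → Bool) (i : ℕ) (b : Bool) : ℝ :=
  (coupling γ (initSeg y i) (y i) b : ℝ) / couplingTotal γ (initSeg y i)

theorem bitLaw_nonneg (y : ℕ → Bool) (i : ℕ) (b : Bool) : 0 ≤ bitLaw γ y i b := by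
  unfold bitLaw; positivity

theorem bitLaw_add (hpos : ∀ c b, 0 < γ c b) (y : ℕ → Bool) (i : ℕ) :
    bitLaw γ y i false + bitLaw γ y i true = 1 := by
  have h : (0 : ℝ) < couplingTotal γ (initSeg y i) := by exact_mod_cast couplingTotal_pos hpos _
  rw [bitLaw, bitLaw, ← add_div, div_eq_one_iff_eq h.ne']
  exact_mod_cast coupling_add _ _

/-- If `y` has complexity rate `h` and the code length of `y` under `γ` is asymptotically optimal,
then compressible strings have exponentially small conditional probability given `y`. -/
theorem eventually_sum_simple_le (hU : IsOptimalPrefixMachine U)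
    (hγ : Computable fun z : List Bool × Bool => γ z.1 z.2) (hpos : ∀ c b, 0 < γ c b)
    {y : ℕ → Bool} {h : ℝ} (hh : 0 < h)
    (hK : Tendsto (fun n : ℕ => (prefixK U (initSeg y n) : ℝ) / n) atTop (𝓝 h))
    (hL : ∀ ε > 0, ∀ᶠ n : ℕ in atTop, codeLen γ y n ≤ (h + ε) * n) {j : ℕ} (hj : 2 ≤ j) :
    ∀ᶠ n : ℕ in atTop, ∑ s ∈ (strs n).toFinset with prefixK U s < n - 2 * (n / j),
      ∏ i ∈ Finset.range n, bitLaw γ y i (s.getD i false) ≤ (1 / 2) ^ (n / j) := by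
  obtain ⟨c, hc⟩ := prefixK_le_of_simple_strings hU hγ hpos (computable_coupling hγ)
    (computable_couplingTotal hγ) (couplingTotal_pos hpos) coupling_uniform
  have hj0 : (0 : ℝ) < j := by exact_mod_cast (by omega : 0 < j)
  -- With `r = n / j` and `l = n - 2 * r` the saving is `r`. The three errors in code length,
  -- complexity and coding, each about `n / (8 * j)`, and the roundings stay below it once `n ≥ 4 *
  -- j`.
  set ε : ℝ := 1 / (8 * j) with hε
  have hε0 : 0 < ε := by positivity
  have hε1 : ε ≤ 1 := by
    rw [hε, div_le_one (by positivity)]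
    have : (2 : ℝ) ≤ j := by exact_mod_cast hj
    linarith
  set C := ⌈h⌉₊ + 4 with hC
  filter_upwards [eventually_gt_atTop 0, eventually_ge_atTop (4 * j), hL ε hε0,
    hK.eventually_const_lt (show h - ε < h by linarith), eventually_slack_le C c hε0]
    with n hn0 hnj hLn hKn hs
  by_contra! hcon
  have hn : (0 : ℝ) < n := by exact_mod_cast hn0
  rw [lt_div_iff₀ hn] at hKn
  set r := n / j with hr
  set m := ⌈codeLen γ y n⌉₊ with hm
  have hr2 : 2 * r ≤ n := by
    have := Nat.div_mul_le_self n j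
    nlinarith
  have hm1 : (m : ℝ) ≤ (h + ε) * n + 1 := by
    have h1 : m ≤ ⌈(h + ε) * n⌉₊ := Nat.ceil_le_ceil hLn
    have h2 := Nat.ceil_lt_add_one (show 0 ≤ (h + ε) * n by positivity)
    have h3 : (m : ℝ) ≤ (⌈(h + ε) * n⌉₊ : ℝ) := by exact_mod_cast h1
    linarith
  have hM : m + r + (n - 2 * r) ≤ C * n + C := by
    have h1 : (h : ℝ) ≤ ⌈h⌉₊ := Nat.le_ceil h
    have h2 : (m : ℝ) ≤ ((⌈h⌉₊ + 1) * n + 1 : ℕ) := by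
      push_cast
      nlinarith
    have h3 : m ≤ (⌈h⌉₊ + 1) * n + 1 := by exact_mod_cast h2
    rw [hC]
    nlinarith [Nat.sub_le n (2 * r)]
  have hD : (0 : ℝ) < ∏ i ∈ Finset.range n, (couplingTotal γ (initSeg y i) : ℝ) :=
    Finset.prod_pos fun i _ => by exact_mod_cast couplingTotal_pos hpos _
  have key := hc y n (n - 2 * r) r m (C * n + C) (by rw [hC]; nlinarith) (by omega) (by omega)
    (by omega) hM (prod_le_two_pow_ceil_codeLen hpos y n) ?_
  · have k1 : (prefixK U (initSeg y n) : ℝ) + n ≤ m + r + (n - 2 * r : ℕ) +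
        6 * (Nat.size (C * n + C) : ℝ) + c := by exact_mod_cast key
    rw [Nat.cast_sub hr2] at k1
    push_cast at k1
    have k2 : (n : ℝ) / j - 1 < r := by
      have := Nat.lt_div_mul_add (a := n) (b := j) (by omega)
      have h3 : (n : ℝ) < r * j + j := by exact_mod_cast this
      rw [sub_lt_iff_lt_add, div_lt_iff₀ hj0]
      linarith
    have k3 : (n : ℝ) / j = 8 * (ε * n) := by rw [hε]; field_simp
    have k4 : 4 ≤ (n : ℝ) / j := by
      rw [le_div_iff₀ hj0]; exact_mod_cast hnj
    nlinarith
  · have e1 : ∀ s : List Bool, ∏ i ∈ Finset.range n, bitLaw γ y i (s.getD i false) =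
        (wprod (coupling γ) (initSeg y n) s : ℕ) /
          ∏ i ∈ Finset.range n, (couplingTotal γ (initSeg y i) : ℝ) := by
      intro s
      rw [wprod, length_initSeg, Nat.cast_prod, ← Finset.prod_div_distrib]
      refine Finset.prod_congr rfl fun i hi => ?_
      have hi := Finset.mem_range.1 hi
      rw [take_initSeg y hi.le, getD_initSeg y hi, bitLaw]
    simp_rw [e1] at hcon
    rw [← Finset.sum_div, lt_div_iff₀ hD, one_div, inv_pow, inv_mul_lt_iff₀ (by positivity)] at hcon
    rw [← List.sum_toFinset _ (nodup_strs n), ← Finset.sum_filter]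
    exact_mod_cast hcon.le

open Classical in
/-- An exponential Markov bound for the code length of the selected bits. -/
theorem sum_tilt_le (hpos : ∀ c b, 0 < γ c b) (y : ℕ → Bool) (n e : ℕ) {v : ℝ}
    (hv : v ≤ ∑ i ∈ Finset.range n, if y i then errProb γ (initSeg y i) true ^ 2 else 0) :
    ∑ s ∈ (strs n).toFinset with
        (∏ i ∈ Finset.range n, bif y i then tilt γ (initSeg y i) (s.getD i false) else 1) <
          2 ^ e * ∏ i ∈ Finset.range n, bif y i then couplingTotal γ (initSeg y i) else 1,
      ∏ i ∈ Finset.range n, bitLaw γ y i (s.getD i false) ≤ 2 ^ e * Real.exp (-v / 4) := by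
  set ρ : ℕ → Bool → ℝ := fun i b =>
    bif y i then (tilt γ (initSeg y i) b : ℝ) / couplingTotal γ (initSeg y i) else 1 with hρ
  have hT : ∀ c, (0 : ℝ) < couplingTotal γ c := fun c => by exact_mod_cast couplingTotal_pos hpos c
  have hρpos : ∀ i b, 0 < ρ i b := by
    intro i b
    have h1 : (0 : ℝ) < tilt γ (initSeg y i) b := by exact_mod_cast tilt_pos hpos _ _
    have h2 := hT (initSeg y i)
    simp only [hρ]
    cases y i
    · simp
    · simpa using div_pos h1 h2
  have hsum : ∑ s ∈ (strs n).toFinset, ∏ i ∈ Finset.range n,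
      (bitLaw γ y i (s.getD i false) / ρ i (s.getD i false)) =
      ∏ i ∈ Finset.range n, (bitLaw γ y i false / ρ i false + bitLaw γ y i true / ρ i true) := by
    rw [List.sum_toFinset _ (nodup_strs n)]
    exact sum_strs_prod n (fun i _ b => bitLaw γ y i b / ρ i b) _ fun _ _ _ _ => rfl
  -- At a one of `y`, the conditional mean of the inverse likelihood ratio `1 / ρ` is `1 - β² / ((2α
  -- + β)(2α + 3β)) ≤ 1 - e² / 4`, where `e = β / (α + β)`. Half the bias of the true law makes the
  -- gain quadratic in `e` with no logarithms.
  have hfac : ∀ i, bitLaw γ y i false / ρ i false + bitLaw γ y i true / ρ i true ≤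
      Real.exp (-(if y i then errProb γ (initSeg y i) true ^ 2 else 0) / 4) := by
    intro i
    cases hy : y i
    · simp only [hρ, hy, cond_false, div_one, bitLaw_add hpos]; simp
    · refine le_trans ?_ (Real.add_one_le_exp _)
      have h1 : (0 : ℝ) < γ (initSeg y i) true := by exact_mod_cast hpos _ true
      have h2 : (0 : ℝ) < γ (initSeg y i) false := by exact_mod_cast hpos _ false
      simp only [hρ, hy, cond_true, bitLaw, coupling, tilt, couplingTotal, errProb, cond_false,
        if_true, Bool.not_true]
      push_cast
      generalize (γ (initSeg y i) true : ℝ) = α at *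
      generalize (γ (initSeg y i) false : ℝ) = β at *
      have e1 : α / (2 * (β + α)) / ((2 * α + β) / (2 * (β + α))) +
          (α + 2 * β) / (2 * (β + α)) / ((2 * α + 3 * β) / (2 * (β + α))) =
          1 - β ^ 2 / ((2 * α + β) * (2 * α + 3 * β)) := by
        field_simp; ring
      rw [e1]
      have e2 : β ^ 2 / (4 * (β + α) ^ 2) ≤ β ^ 2 / ((2 * α + β) * (2 * α + 3 * β)) := by
        refine div_le_div_of_nonneg_left (by positivity) (by positivity) ?_
        nlinarith [sq_nonneg β]
      have e3 : -(β / (β + α)) ^ 2 / 4 = -(β ^ 2 / (4 * (β + α) ^ 2)) := by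
        field_simp
      rw [e3]
      linarith
  have hprod : ∏ i ∈ Finset.range n,
      (bitLaw γ y i false / ρ i false + bitLaw γ y i true / ρ i true) ≤ Real.exp (-v / 4) := by
    refine (Finset.prod_le_prod (fun i _ => add_nonneg
      (div_nonneg (bitLaw_nonneg _ _ _) (hρpos _ _).le)
      (div_nonneg (bitLaw_nonneg _ _ _) (hρpos _ _).le)) fun i _ => hfac i).trans ?_
    rw [← Real.exp_sum, ← Finset.sum_div, Finset.sum_neg_distrib]
    exact Real.exp_le_exp.2 (by linarith)
  refine le_trans ?_ (mul_le_mul_of_nonneg_left (hsum.le.trans hprod) (by positivity))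
  rw [Finset.mul_sum]
  -- On the bad event the likelihood ratio is below `2 ^ e`, so its indicator is at most `2 ^ e /
  -- ρ`, as in Markov's inequality.
  refine le_trans (Finset.sum_le_sum fun s hs => ?_)
    (Finset.sum_le_sum_of_subset_of_nonneg (Finset.filter_subset _ _) fun s _ _ =>
      mul_nonneg (by positivity) (Finset.prod_nonneg fun i _ =>
        div_nonneg (bitLaw_nonneg _ _ _) (hρpos _ _).le))
  have hlt := (Finset.mem_filter.1 hs).2
  rw [Finset.prod_div_distrib, mul_div_assoc']
  have hR : 0 < ∏ i ∈ Finset.range n, ρ i (s.getD i false) := Finset.prod_pos fun i _ => hρpos _ _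
  rw [le_div_iff₀ hR, mul_comm]
  refine mul_le_mul_of_nonneg_right ?_ (Finset.prod_nonneg fun i _ => bitLaw_nonneg _ _ _)
  have hTT : (0 : ℝ) < ∏ i ∈ Finset.range n,
      ((bif y i then couplingTotal γ (initSeg y i) else 1 : ℕ) : ℝ) := by
    refine Finset.prod_pos fun i _ => ?_
    cases y i
    · simp
    · simpa using hT (initSeg y i)
  have e1 : ∏ i ∈ Finset.range n, ρ i (s.getD i false) =
      (∏ i ∈ Finset.range n, ((bif y i then tilt γ (initSeg y i) (s.getD i false) else 1 : ℕ) : ℝ)) /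
      ∏ i ∈ Finset.range n, ((bif y i then couplingTotal γ (initSeg y i) else 1 : ℕ) : ℝ) := by
    rw [← Finset.prod_div_distrib]
    refine Finset.prod_congr rfl fun i _ => ?_
    simp only [hρ]; cases y i <;> simp
  rw [e1, div_le_iff₀ hTT]
  exact_mod_cast hlt.le

/-- The total of `tilt` is twice that of `coupling`. This collects the factors of two into one bit
per selected position. -/
theorem prod_two_eq (y : ℕ → Bool) (n : ℕ) :
    (∏ i ∈ Finset.range n, bif y i then 2 else 1) = 2 ^ (initSeg y n).count true := by
  induction n with
  | zero => rfl
  | succ n ih =>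
    rw [Finset.prod_range_succ, ih, initSeg_succ, List.count_append, pow_add]
    cases y n <;> simp

/-- Up to a factor `2` for the rounding, the terms are powers of `2 ^ (-1 / j)`. -/
theorem summable_half_pow_div {j : ℕ} (hj : 0 < j) :
    Summable fun n : ℕ => (1 / 2 : ℝ) ^ (n / j) := by
  have hj0 : (0 : ℝ) < j := by exact_mod_cast hj
  set q : ℝ := (1 / 2 : ℝ) ^ (1 / j : ℝ) with hq
  have hq0 : 0 < q := Real.rpow_pos_of_pos (by norm_num) _
  have hq1 : q < 1 := Real.rpow_lt_one (by norm_num) (by norm_num) (by positivity)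
  refine Summable.of_nonneg_of_le (fun n => by positivity) (fun n => ?_)
    ((summable_geometric_of_lt_one hq0.le hq1).mul_left 2)
  have e1 : q ^ n = (1 / 2 : ℝ) ^ ((n : ℝ) / j) := by
    rw [hq, ← Real.rpow_natCast, ← Real.rpow_mul (by norm_num)]
    congr 1; ring
  have e2 : 2 * (1 / 2 : ℝ) ^ ((n : ℝ) / j) = (1 / 2 : ℝ) ^ ((n : ℝ) / j - 1) := by
    rw [Real.rpow_sub (by norm_num), Real.rpow_one]; ring
  rw [e1, e2, ← Real.rpow_natCast]
  refine Real.rpow_le_rpow_of_exponent_ge (by norm_num) (by norm_num) ?_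
  have h3 : (n : ℝ) < (n / j : ℕ) * j + j := by
    exact_mod_cast Nat.lt_div_mul_add (a := n) (b := j) hj
  rw [sub_le_iff_le_add, div_le_iff₀ hj0]
  linarith

/-- If `y` has positive complexity rate and the code length of `y` under `γ` is asymptotically
optimal, then there is an incompressible sequence whose selected subsequence is compressible
given `y`. -/
theorem exists_compressible_selection (hU : IsOptimalPrefixMachine U)
    (hγ : Computable fun z : List Bool × Bool => γ z.1 z.2) (hpos : ∀ c b, 0 < γ c b)
    {y : ℕ → Bool} {h : ℝ} (hh : 0 < h)
    (hK : Tendsto (fun n : ℕ => (prefixK U (initSeg y n) : ℝ) / n) atTop (𝓝 h))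
    (hL : ∀ ε > 0, ∀ᶠ n : ℕ in atTop, codeLen γ y n ≤ (h + ε) * n) :
    ∃ x : ℕ → Bool, Tendsto (fun n : ℕ => (prefixK U (initSeg x n) : ℝ) / n) atTop (𝓝 1) ∧
      ∃ δ > 0, ∃ᶠ n : ℕ in atTop,
        (condK U (select (initSeg x n) (initSeg y n)) (initSeg y n) : ℝ) ≤
          (initSeg y n).count true - δ * n := by
  classical
  obtain ⟨ε, hε, hfreq⟩ := exists_frequently_le_sum_sq hU hγ hpos hh hK hL
  -- Then `2 ^ (n / J) ≤ exp (ε * n / 8)`, which leaves half of the exponent `ε * n / 4` in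
  -- `sum_tilt_le`.
  obtain ⟨J, hJ⟩ := exists_nat_gt (8 / ε)
  have hJ0 : (0 : ℝ) < J := lt_trans (by positivity) hJ
  have hJpos : 0 < J := by exact_mod_cast hJ0
  let V : ℕ → ℝ := fun n =>
    ∑ i ∈ Finset.range n, if y i then errProb γ (initSeg y i) true ^ 2 else 0
  -- The bias is sufficient only for infinitely many `n`. Requiring it inside the event makes the
  -- event empty for the other `n`, so the probabilities are summable over all `n`.
  let A₀ : ℕ → Set (List Bool) := fun n => {s | ε * n ≤ V n ∧
    (∏ i ∈ Finset.range n, bif y i then tilt γ (initSeg y i) (s.getD i false) else 1) <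
      2 ^ (n / J) * ∏ i ∈ Finset.range n, bif y i then couplingTotal γ (initSeg y i) else 1}
  -- The shift by `2` ensures that `2 * (n / (j + 2)) ≤ n`. Avoiding these events for every `j`
  -- forces rate one.
  let A₁ : ℕ → ℕ → Set (List Bool) := fun j n => {s | prefixK U s < n - 2 * (n / (j + 2))}
  have hmass₀ : ∀ n, ∑ s ∈ (strs n).toFinset with s ∈ A₀ n,
      ∏ i ∈ Finset.range n, bitLaw γ y i (s.getD i false) ≤ Real.exp (-(ε / 8)) ^ n := by
    intro n
    by_cases hn : ε * n ≤ V n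
    · have h1 := sum_tilt_le hpos y n (n / J) hn
      have h2 : (2 : ℝ) ^ (n / J) ≤ Real.exp (ε * n / 8) := by
        have h3 : (2 : ℝ) ≤ Real.exp 1 := by linarith [Real.add_one_le_exp (1 : ℝ)]
        calc (2 : ℝ) ^ (n / J) ≤ Real.exp 1 ^ (n / J) := by gcongr
          _ = Real.exp ((n / J : ℕ) : ℝ) := by rw [← Real.exp_nat_mul, mul_one]
          _ ≤ _ := by
            refine Real.exp_le_exp.2 (Nat.cast_div_le.trans ?_)
            rw [div_le_iff₀ hJ0]
            rw [div_lt_iff₀ hε] at hJ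
            have : (0 : ℝ) ≤ n := Nat.cast_nonneg n
            nlinarith
      have h4 : (2 : ℝ) ^ (n / J) * Real.exp (-(ε * n) / 4) ≤ Real.exp (-(ε / 8)) ^ n := by
        calc (2 : ℝ) ^ (n / J) * Real.exp (-(ε * n) / 4)
            ≤ Real.exp (ε * n / 8) * Real.exp (-(ε * n) / 4) := by gcongr
          _ = Real.exp (-(ε / 8)) ^ n := by
            rw [← Real.exp_add, ← Real.exp_nat_mul]; congr 1; ring
      refine (Finset.sum_congr ?_ fun _ _ => rfl).le.trans (h1.trans h4)
      ext s
      simp only [Finset.mem_filter]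
      exact and_congr_right fun _ => ⟨fun hs => hs.2, fun hs => ⟨hn, hs⟩⟩
    · rw [Finset.filter_false_of_mem fun s _ hs => hn hs.1, Finset.sum_empty]
      positivity
  have hmass₁ : ∀ j, ∀ᶠ n : ℕ in atTop, ∑ s ∈ (strs n).toFinset with s ∈ A₁ j n,
      ∏ i ∈ Finset.range n, bitLaw γ y i (s.getD i false) ≤ (1 / 2) ^ (n / (j + 2)) := by
    intro j
    refine (eventually_sum_simple_le hU hγ hpos hh hK hL (j := j + 2) (by omega)).mono fun n hn =>
      (Finset.sum_congr ?_ fun _ _ => rfl).le.trans hn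
    ext s
    simp only [Finset.mem_filter]
    exact Iff.rfl
  obtain ⟨x, hx⟩ := exists_avoiding (ι := Option ℕ) (bitLaw_nonneg (γ := γ) y) (bitLaw_add hpos y)
    (fun j => j.elim A₀ A₁)
    (b := fun j => j.elim (fun n => Real.exp (-(ε / 8)) ^ n) fun j n => (1 / 2) ^ (n / (j + 2)))
    (fun j => match j with
      | none => summable_geometric_of_lt_one (Real.exp_pos _).le (Real.exp_lt_one_iff.2 (by linarith))
      | some j => summable_half_pow_div (Nat.succ_pos _))
    (fun j => match j with
      | none => Eventually.of_forall fun n => by convert hmass₀ n <;> rfl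
      | some j => (hmass₁ j).mono fun n hn => by convert hn <;> rfl)
  have hx₀ : ∀ᶠ n : ℕ in atTop, initSeg x n ∉ A₀ n := hx none
  have hx₁ : ∀ j, ∀ᶠ n : ℕ in atTop, initSeg x n ∉ A₁ j n := fun j => hx (some j)
  -- The saving `⌊n / J⌋` exceeds `n / J - 1`; after rounding and the coding error `n / (4 * J)`, at
  -- least `n / (4 * J)` remains once `n ≥ 2 * J`.
  refine ⟨x, ?_, 1 / (4 * J), by positivity, ?_⟩
  · obtain ⟨c, hc⟩ := condK_le_length hU
    refine tendsto_order.2 ⟨fun a ha => ?_, fun a ha => ?_⟩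
    · obtain ⟨j, hj⟩ := exists_nat_gt (2 / (1 - a))
      filter_upwards [hx₁ j, eventually_gt_atTop 0] with n hn hn0
      simp only [A₁, Set.mem_ofPred_eq, not_lt] at hn
      have hnr : (0 : ℝ) < n := by exact_mod_cast hn0
      have h1 : (n : ℝ) ≤ prefixK U (initSeg x n) + 2 * (n / (j + 2) : ℕ) := by
        have : n ≤ prefixK U (initSeg x n) + 2 * (n / (j + 2)) := by omega
        exact_mod_cast this
      have h2 : ((n / (j + 2) : ℕ) : ℝ) ≤ n / (j + 2) := by
        refine Nat.cast_div_le.trans_eq ?_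
        push_cast; rfl
      have h3 : 2 * ((n : ℝ) / (j + 2)) < (1 - a) * n := by
        rw [mul_div_assoc', div_lt_iff₀ (by positivity)]
        rw [div_lt_iff₀ (by linarith)] at hj
        have : 2 < (1 - a) * ((j : ℝ) + 2) := by nlinarith
        nlinarith
      rw [lt_div_iff₀ hnr]
      linarith
    · filter_upwards [eventually_slack_le 1 c (show 0 < (a - 1) / 2 by linarith),
        eventually_gt_atTop 0] with n hn hn0
      have hnr : (0 : ℝ) < n := by exact_mod_cast hn0
      have h1 := hc (initSeg x n) []
      rw [length_initSeg] at h1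
      have h2 : Nat.size n ≤ Nat.size (1 * n + 1) := Nat.size_le_size (by omega)
      have h3 : (prefixK U (initSeg x n) : ℝ) ≤ n + 6 * (Nat.size (1 * n + 1) : ℝ) + c := by
        have : prefixK U (initSeg x n) ≤ n + 6 * Nat.size (1 * n + 1) + c := by
          unfold prefixK; omega
        exact_mod_cast this
      rw [div_lt_iff₀ hnr]
      nlinarith
  · obtain ⟨c, hc⟩ := condK_select_le_of_weights hU (computable_tilt hγ) (tilt_pos hpos)
    refine (hfreq.and_eventually (hx₀.and ((eventually_slack_le 1 c
      (show (0 : ℝ) < 1 / (4 * J) by positivity)).and (eventually_ge_atTop (2 * J))))).mono ?_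
    rintro n ⟨hV, hA, hs, hn⟩
    simp only [A₀, Set.mem_ofPred_eq, not_and, not_lt] at hA
    have hA := hA hV
    set N := (initSeg y n).count true with hN
    set e := n / J with he
    have hNn : N ≤ n := List.count_le_length.trans_eq (length_initSeg y n)
    have hcongr : (∏ i ∈ Finset.range n,
        bif y i then tilt γ (initSeg y i) ((initSeg x n).getD i false) else 1) =
        ∏ i ∈ Finset.range n, bif y i then tilt γ (initSeg y i) (x i) else 1 :=
      Finset.prod_congr rfl fun i hi => by rw [getD_initSeg x (Finset.mem_range.1 hi)]
    rw [hcongr] at hA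
    set Z := ∏ i ∈ Finset.range n, bif y i then couplingTotal γ (initSeg y i) else 1 with hZ
    have hZpos : 0 < Z := Finset.prod_pos fun i _ => by
      have := couplingTotal_pos hpos (initSeg y i)
      cases y i <;> simp [this]
    have htot : (∏ i ∈ Finset.range n,
        bif y i then tilt γ (initSeg y i) false + tilt γ (initSeg y i) true else 1) = 2 ^ N * Z := by
      rw [hN, ← prod_two_eq, hZ, ← Finset.prod_mul_distrib]
      refine Finset.prod_congr rfl fun i _ => ?_
      rw [tilt_add]; cases y i <;> simp
    -- No bit has more than the total weight, so at most `N` bits can be saved and `N - e` is not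
    -- truncated.
    have heN : e ≤ N := by
      have h1 : (∏ i ∈ Finset.range n, bif y i then tilt γ (initSeg y i) (x i) else 1) ≤
          ∏ i ∈ Finset.range n,
            bif y i then tilt γ (initSeg y i) false + tilt γ (initSeg y i) true else 1 := by
        refine Finset.prod_le_prod' fun i _ => ?_
        cases y i <;> cases x i <;> simp
      rw [htot] at h1
      exact (Nat.pow_le_pow_iff_right (by norm_num)).1
        (le_of_mul_le_mul_right (hA.trans h1) hZpos)
    have h1 := hc x y n (N - e) (by
      rw [htot]
      calc 2 ^ N * Z = 2 ^ (N - e) * (2 ^ e * Z) := by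
            rw [← mul_assoc, ← pow_add, Nat.sub_add_cancel heN]
        _ ≤ _ := Nat.mul_le_mul_left _ hA)
    have h2 : Nat.size (N - e) ≤ Nat.size (1 * n + 1) :=
      Nat.size_le_size ((Nat.sub_le N e).trans (hNn.trans (by omega)))
    have h3 : (condK U (select (initSeg x n) (initSeg y n)) (initSeg y n) : ℝ) ≤
        (N - e : ℕ) + 6 * (Nat.size (1 * n + 1) : ℝ) + c := by
      have : condK U (select (initSeg x n) (initSeg y n)) (initSeg y n) ≤
          (N - e) + 6 * Nat.size (1 * n + 1) + c := by omega
      exact_mod_cast this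
    rw [Nat.cast_sub heN] at h3
    have h4 : (n : ℝ) / J < e + 1 := by
      rw [div_lt_iff₀ hJ0]
      have : (n : ℝ) < (n / J : ℕ) * J + J := by
        exact_mod_cast Nat.lt_div_mul_add (a := n) (b := J) hJpos
      rw [← he] at this
      linarith
    have h5 : (2 : ℝ) ≤ n / J := by
      rw [le_div_iff₀ hJ0]; exact_mod_cast hn
    have h6 : 1 / (4 * (J : ℝ)) * n = n / J / 4 := by field_simp
    rw [h6] at hs ⊢
    linarith

/-- If the code length of `y` under a computable measure is asymptotically its complexity, and the
ones of `y` have positive density, then selection by `y` preserves incompressibility only if `y`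
has complexity rate zero. -/
theorem rate_eq_zero_of_select (hU : IsOptimalPrefixMachine U)
    (hγ : Computable fun z : List Bool × Bool => γ z.1 z.2) (hpos : ∀ c b, 0 < γ c b)
    {y : ℕ → Bool} {h d : ℝ} (hd : 0 < d)
    (hdens : Tendsto (fun n : ℕ => ((initSeg y n).count true : ℝ) / n) atTop (𝓝 d))
    (hK : Tendsto (fun n : ℕ => (prefixK U (initSeg y n) : ℝ) / n) atTop (𝓝 h))
    (hL : ∀ ε > 0, ∀ᶠ n : ℕ in atTop, codeLen γ y n ≤ (h + ε) * n)
    (hsel : ∀ x : ℕ → Bool,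
      Tendsto (fun n : ℕ => (prefixK U (initSeg x n) : ℝ) / n) atTop (𝓝 1) →
      Tendsto (fun n : ℕ =>
          (condK U (select (initSeg x n) (initSeg y n)) (initSeg y n) : ℝ) /
            (select (initSeg x n) (initSeg y n)).length)
        atTop (𝓝 1)) : h = 0 := by
  have h0 : 0 ≤ h := ge_of_tendsto' hK fun n => by positivity
  by_contra hne
  obtain ⟨x, hx, δ, hδ, hfreq⟩ := exists_compressible_selection hU hγ hpos
    (lt_of_le_of_ne h0 (Ne.symm hne)) hK hL
  -- Multiplying by the density turns the relative deviation into `(K - N) / n`, which would tend to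
  -- `0` although it is at most `-δ` infinitely often.
  have h1 := ((hsel x hx).sub_const 1).mul hdens
  rw [sub_self, zero_mul] at h1
  obtain ⟨n, hn, h2, h3, hn0⟩ := (hfreq.and_eventually ((h1.eventually_const_lt
    (show -δ < 0 by linarith)).and ((hdens.eventually_const_lt hd).and
      (eventually_gt_atTop 0)))).exists
  have hnr : (0 : ℝ) < n := by exact_mod_cast hn0
  rw [length_select (by simp)] at h2
  have hN : (0 : ℝ) < (initSeg y n).count true := (div_pos_iff_of_pos_right hnr).1 h3
  rw [div_sub_one hN.ne', div_mul_div_cancel₀ hN.ne', lt_div_iff₀ hnr] at h2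
  linarith

end RandomSelection

end AlgComplexity

/-! ### The equivalence -/

theorem proposition2 (U : List Bool → List Bool →. List Bool) (hU : IsOptimalPrefixMachine U)
    (P : Measure (ℕ → Bool)) (hP : IsProbabilityMeasure P) (hPc : IsComputableProb P)
    (y : ℕ → Bool) (hy : HasMaximalComplexityRate U P y)
    (hdens : ∃ d : ℝ, 0 < d ∧
      Tendsto (fun n : ℕ => ((initSeg y n).count true : ℝ) / n) atTop (𝓝 d)) :
    Tendsto (fun n : ℕ => (prefixK U (initSeg y n) : ℝ) / n) atTop (𝓝 0) ↔
    ∀ x : ℕ → Bool,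
      Tendsto (fun n : ℕ => (prefixK U (initSeg x n) : ℝ) / n) atTop (𝓝 1) →
      Tendsto (fun n : ℕ =>
          (condK U (select (initSeg x n) (initSeg y n)) (initSeg y n) : ℝ) /
            (select (initSeg x n) (initSeg y n)).length)
        atTop (𝓝 1) := by
  obtain ⟨d, hd, hdens⟩ := hdens
  refine ⟨fun h0 x hx => tendsto_condK_select hU hd hdens h0 hx, fun hsel => ?_⟩
  obtain ⟨hPpos, h, hK, hPlim⟩ := hy
  obtain ⟨γ, hγ, hpos, hdom⟩ := exists_weights hPc
  -- Domination of `P` up to the factor `3 * (n + 1)` gives a code length of at most `-log₂ P + log₂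
  -- (3 * n + 3)`. Maximal complexity rate enters here, through the equality of the two limits.
  have hL : ∀ ε > 0, ∀ᶠ n : ℕ in atTop, codeLen γ y n ≤ (h + ε) * n := by
    intro ε hε
    have hlog := ((tendsto_log_linear_div 2).div_const (Real.log 2))
    rw [zero_div] at hlog
    filter_upwards [hPlim.eventually_lt_const (show h < h + ε / 2 by linarith),
      hlog.eventually_lt_const (show 0 < ε / 2 by linarith), eventually_gt_atTop 0] with n h1 h2 hn0
    have hn : (0 : ℝ) < n := by exact_mod_cast hn0
    rw [div_lt_iff₀ hn] at h1
    rw [div_right_comm, div_lt_iff₀ hn] at h2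
    have h3 := hdom y n
    have hG : 0 < ∏ i ∈ Finset.range n, (γ (initSeg y i) (y i) : ℝ) :=
      Finset.prod_pos fun i _ => by have := hpos (initSeg y i) (y i); positivity
    have hT : 0 < ∏ i ∈ Finset.range n, ((γ (initSeg y i) false : ℝ) + γ (initSeg y i) true) :=
      Finset.prod_pos fun i _ => by have := hpos (initSeg y i) false; positivity
    have h4 : (∏ i ∈ Finset.range n, ((γ (initSeg y i) false : ℝ) + γ (initSeg y i) true)) /
        ∏ i ∈ Finset.range n, (γ (initSeg y i) (y i) : ℝ) ≤
        ((2 + 1) * n + (2 + 1)) / P.real (cylinder (initSeg y n)) := by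
      rw [div_le_div_iff₀ hG (hPpos n)]
      linarith
    have h5 := Real.logb_le_logb_of_le (b := 2) (by norm_num) (by positivity) h4
    rw [← codeLen_eq hpos, Real.logb_div (by positivity) (hPpos n).ne'] at h5
    rw [Nat.cast_ofNat] at h2
    refine h5.trans ?_
    rw [show (h + ε) * (n : ℝ) = ε / 2 * n + (h + ε / 2) * n by ring, sub_eq_add_neg]
    exact add_le_add h2.le h1.le
  rw [rate_eq_zero_of_select hU hγ hpos hd hdens hK hL hsel] at hK
  exact hK
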